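/- Let $H_{\mathbb Z}=\mathbb Z^m$, $H=\mathbb C^m$, let $n\ge 1$, let $Q$ be a non-degenerate integral bilinear form on $H_{\mathbb Z}$ that is symmetric if $n$ is even and skew-symmetric if $n$ is odd, and let $h^{p,n-p}\ge 0$ ($0\le p\le n$) be integers with sum $m$. Put $f^p=\sum_{i\ge p}h^{i,n-i}$. Let $D$ be the period domain of all polarized Hodge structures of weight $n$ of this type, that is, of all filtrations $H=F^0\supseteq F^1\supseteq\cdots\supseteq F^n\supseteq F^{n+1}=0$ with $\dim F^p=f^p$, $H=F^p\oplus\overline{F^{n-p+1}}$, $Q(F^p,F^{n-p+1})=0$ and $(\sqrt{-1})^{2p-n}Q(v,\bar v)>0$ for $0\neq v\in H^{p,n-p}=F^p\cap\overline{F^{n-p}}$, for $0\le p\le n$. Let $\Gamma\subseteq \mathrm{Aut}(H_{\mathbb Z},Q)$ be a subgroup, let $S$ be a connected (finite-dimensional) complex manifold, and let $\Phi:S\to\Gamma\backslash D$ be a period map: it has local lifts to $D$ that are holomorphic (each $F^p$ is locally spanned by a holomorphic frame) and satisfy Griffiths transversality. Let $\pi:\tilde S\to S$ be the universal cover and let $\Phi:\tilde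 S\to D$ be a lifted period map, i.e. a holomorphic map that lifts $\Phi\circ\pi$. Write $F^\bullet_z$ for the filtration $\Phi(z)$. Fix a base point $z_o\in\tilde S$ and let $o=\Phi(z_o)$, with Hodge decomposition $H=\bigoplus_p H_o^{p,n-p}$. Let $\mathfrak g$ be the Lie algebra of all $X\in \mathrm{End}(H)$ with $Q(Xu,v)+Q(u,Xv)=0$ for all $u,v\in H$, let $\mathfrak g^{-k,k}$ be the subspace of all $X\in\mathfrak g$ with $XH_o^{p,n-p}\subseteq H_o^{p-k,n-p+k}$ for all $p$, and let $\mathfrak n_-=\bigoplus_{k\ge1}\mathfrak g^{-k,k}$ and $N_-=\exp(\mathfrak n_-)$. Identify $N_-$ with its orbit $N_-\cdot o$ of filtrations of $H$, and put $$\tilde S^{\vee}=\Phi^{-1}(N_-\cap D)\subseteq\tilde S .$$ Then: 1. $\tilde S^\vee$ is an open complex submanifold of $\tilde S$. 2. $\tilde S\setminus\tilde S^\vee$ is an analytic subvariety of $\tilde S$, i.e. near every point of $\tilde S$ it is the common zero locus of finitely many holomorphic functions. 3. $\mathrm{codim}_{\mathbb C}(\tilde S\setminus\tilde S^\vee)\ge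 1$ (the codimension is the least codimension at a regular point, and $\infty$ for the empty set). 4. $\tilde S\setminus\tilde S^\vee$ is cut out by block leading principal minors. Let $\eta=(\eta_0,\dots,\eta_{m-1})$ be a basis of $H$ adapted to the Hodge decomposition of $o$, i.e. $H_o^{p,n-p}$ is spanned by the $\eta_i$ with $f^{p+1}\le i<f^p$, for $0\le p\le n$. For $z\in\tilde S$ let $\zeta=(\zeta_0,\dots,\zeta_{m-1})$ be a basis of $H$ adapted to the filtration $F_z^\bullet$, i.e. $F_z^p$ is spanned by the $\zeta_i$ with $i<f^p$, for $0\le p\le n$. Let $A$ be the transition matrix, $\zeta=A\eta$, with blocks $A^{(\alpha,\beta)}$, $0\le\alpha,\beta\le n$, whose rows are the $i$ with $f^{n-\alpha+1}\le i<f^{n-\alpha}$ and whose columns are the $j$ with $f^{n-\beta+1}\le j<f^{n-\beta}$. Then $z\in\tilde S\setminus\tilde S^\vee$ if and only if $\det(A^{(\alpha,\beta)})_{0\le\alpha,\beta\le k}=0$ for some $0\le k\le n$. Moreover, every point of $\tilde S$ has an open neighbourhood $U$ with a basis $\zeta(z)$ adapted to $F_z^\bullet$ that depends holomorphically on $z\in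 U$; for the resulting matrix $A(z)$ these minors are holomorphic on $U$, and $$(\tilde S\setminus\tilde S^\vee)\cap U=\{z\in U:\ \det(A^{(\alpha,\beta)}(z))_{0\le\alpha,\beta\le k}=0\text{ for some }0\le k\le n\}.$$ -/

import Mathlib

open scoped ContDiff Manifold Matrix Topology

noncomputable section

/-! ### Complex analytic subsets of complex manifolds

A complex manifold modelled on a finite-dimensional complex normed space `E` is a charted space `M`
on `E` with `IsManifold 𝓘(ℂ, E) ω M`; holomorphic means complex differentiable. -/

section ComplexManifolds

variable {E : Type*} [NormedAddCommGroup E] [NormedSpace ℂ E]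
  {M : Type*} [TopologicalSpace M] [ChartedSpace E M]

/-- `U` is an open complex submanifold of `M`: it is open and, with the induced charts, a complex
manifold whose inclusion into `M` is locally biholomorphic. -/
def IsOpenComplexSubmanifold (E : Type*) [NormedAddCommGroup E] [NormedSpace ℂ E]
    {M : Type*} [TopologicalSpace M] [ChartedSpace E M] (U : Set M) : Prop :=
  ∃ O : TopologicalSpace.Opens M, (O : Set M) = U ∧ IsManifold 𝓘(ℂ, E) ω O ∧
    IsLocalDiffeomorph 𝓘(ℂ, E) 𝓘(ℂ, E) ω (Subtype.val : O → M)

/-- `Z` is a (closed) analytic subvariety of `M`: near every point of `M` it is the common zero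
locus of finitely many holomorphic functions. -/
def IsAnalyticSubvariety (E : Type*) [NormedAddCommGroup E] [NormedSpace ℂ E]
    {M : Type*} [TopologicalSpace M] [ChartedSpace E M] (Z : Set M) : Prop :=
  ∀ x : M, ∃ U : Set M, IsOpen U ∧ x ∈ U ∧ ∃ (N : ℕ) (g : Fin N → M → ℂ),
    (∀ j, MDifferentiableOn 𝓘(ℂ, E) 𝓘(ℂ, ℂ) (g j) U) ∧ Z ∩ U = {y ∈ U | ∀ j, g j y = 0}

/-- `x` is a regular point of `Z` at which `Z` has codimension `c`: in a holomorphic chart of `M`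
around `x`, the set `Z` is a linear subspace of codimension `c`. -/
def IsRegularPointOfCodim (E : Type*) [NormedAddCommGroup E] [NormedSpace ℂ E]
    {M : Type*} [TopologicalSpace M] [ChartedSpace E M] (Z : Set M) (c : ℕ) (x : M) : Prop :=
  x ∈ Z ∧ ∃ φ ∈ IsManifold.maximalAtlas 𝓘(ℂ, E) ω M, x ∈ φ.source ∧
    ∃ W : Submodule ℂ E, Module.finrank ℂ (E ⧸ W) = c ∧ ∀ y ∈ φ.source, y ∈ Z ↔ φ y ∈ W

/-- The complex codimension of an analytic subvariety `Z`: the least codimension of `Z` at its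
regular points (which are dense in `Z`); it is `⊤` for the empty set. -/
def analyticCodim (E : Type*) [NormedAddCommGroup E] [NormedSpace ℂ E]
    {M : Type*} [TopologicalSpace M] [ChartedSpace E M] (Z : Set M) : ℕ∞ :=
  ⨅ (c : ℕ) (_ : ∃ x, IsRegularPointOfCodim E Z c x), (c : ℕ∞)

/-- `π : T → S` is the universal covering of the complex manifold `S`, with the complex structure
on `T` for which `π` is locally biholomorphic. -/
structure IsUniversalCovering (E : Type*) [NormedAddCommGroup E] [NormedSpace ℂ E]
    {S : Type*} [TopologicalSpace S] [ChartedSpace E S]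
    {T : Type*} [TopologicalSpace T] [ChartedSpace E T] (π : T → S) : Prop where
  isCoveringMap : IsCoveringMap π
  surjective : Function.Surjective π
  simplyConnected : SimplyConnectedSpace T
  isLocalDiffeomorph : IsLocalDiffeomorph 𝓘(ℂ, E) 𝓘(ℂ, E) ω π

end ComplexManifolds

/-! ### Period domains -/

/-- The complex conjugate of a subspace of `ℂ ^ m`. -/
def conjSubspace {m : ℕ} (V : Submodule ℂ (Fin m → ℂ)) : Submodule ℂ (Fin m → ℂ) where
  carrier := {v | star v ∈ V}
  add_mem' := by
    intro a b ha hb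
    simpa using V.add_mem ha hb
  zero_mem' := by simp
  smul_mem' := by
    intro c v hv
    simpa using V.smul_mem (star c) hv

/-- Discrete data of polarized Hodge structures of weight `n = weight` on the lattice
`H_ℤ = ℤ ^ m`: the polarization form `Q(u, v) = uᵀ Q v`, which is non-degenerate and
`(-1) ^ n`-symmetric, and the Hodge numbers `h p = h^{p, n - p}` for `0 ≤ p ≤ n`. -/
structure HodgeData (m : ℕ) where
  weight : ℕ
  weight_pos : 0 < weight
  Q : Matrix (Fin m) (Fin m) ℤ
  Q_symm : Qᵀ = (-1 : ℤ) ^ weight • Q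
  Q_nondeg : Q.det ≠ 0
  h : ℕ → ℕ
  h_sum : ∑ p ∈ Finset.range (weight + 1), h p = m

/-- Sequences `F 0, F 1, F 2, …` of subspaces of `H = ℂ ^ m`. -/
abbrev FiltrationSeq (m : ℕ) : Type := ℕ → Submodule ℂ (Fin m → ℂ)

/-- The image of a filtration under a complex matrix. -/
def FiltrationSeq.act {m : ℕ} (g : Matrix (Fin m) (Fin m) ℂ) (F : FiltrationSeq m) :
    FiltrationSeq m :=
  fun p => (F p).map (Matrix.toLin' g)

namespace HodgeData

variable {m : ℕ} (𝓗 : HodgeData m)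

/-- `f p = h^{n, 0} + ⋯ + h^{p, n - p}`, the dimension of `F p`. -/
def f (p : ℕ) : ℕ := ∑ i ∈ Finset.Icc p 𝓗.weight, 𝓗.h i

/-- The `ℂ`-bilinear extension of the polarization form to `H = ℂ ^ m`. -/
def form (u v : Fin m → ℂ) : ℂ := u ⬝ᵥ (𝓗.Q.map (Int.cast : ℤ → ℂ)) *ᵥ v

/-- The Hodge component `H^{p, n - p} = F^p ∩ conj F^{n - p}` of a Hodge filtration. As `F 0 = ⊤`
and `F i = ⊥` for `i > n`, it vanishes unless `0 ≤ p ≤ n`. -/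
def hodgePiece (F : FiltrationSeq m) (p : ℤ) : Submodule ℂ (Fin m → ℂ) :=
  F p.toNat ⊓ conjSubspace (F ((𝓗.weight : ℤ) - p).toNat)

/-- The compact dual: decreasing filtrations `H = F 0 ⊇ ⋯ ⊇ F n ⊇ F (n + 1) = 0` with
`dim F p = f p` that satisfy the first Hodge-Riemann relation `Q(F^p, F^{n - p + 1}) = 0`. -/
def compactDual : Set (FiltrationSeq m) :=
  {F | F 0 = ⊤ ∧ Antitone F ∧ (∀ p, 𝓗.weight < p → F p = ⊥) ∧
    (∀ p ≤ 𝓗.weight, Module.finrank ℂ (F p) = 𝓗.f p) ∧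
    ∀ p ≤ 𝓗.weight, ∀ u ∈ F p, ∀ v ∈ F (𝓗.weight + 1 - p), 𝓗.form u v = 0}

/-- The period domain `D`: the points of the compact dual with `H = F^p ⊕ conj F^{n - p + 1}` that
satisfy the second Hodge-Riemann relation: `i ^ (2 p - n) Q(v, conj v)` is real and positive for
all non-zero `v` in `H^{p, n - p}`. -/
def periodDomain : Set (FiltrationSeq m) :=
  {F | F ∈ 𝓗.compactDual ∧
    (∀ p ≤ 𝓗.weight, IsCompl (F p) (conjSubspace (F (𝓗.weight + 1 - p)))) ∧
    ∀ p ≤ 𝓗.weight, ∀ v ∈ 𝓗.hodgePiece F p, v ≠ 0 →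
      0 < (Complex.I ^ (2 * (p : ℤ) - 𝓗.weight) * 𝓗.form v (star v)).re ∧
      (Complex.I ^ (2 * (p : ℤ) - 𝓗.weight) * 𝓗.form v (star v)).im = 0}

/-! ### The unipotent orbit of a base point -/

/-- The Lie algebra `𝔤` of the isometry group of `Q` on `H`. -/
def lieG : Submodule ℂ (Matrix (Fin m) (Fin m) ℂ) where
  carrier := {X | ∀ u v, 𝓗.form (X *ᵥ u) v + 𝓗.form u (X *ᵥ v) = 0}
  add_mem' := by
    intro X Y hX hY u v
    have h1 := hX u v
    have h2 := hY u v
    simp only [form, Matrix.add_mulVec, Matrix.mulVec_add, add_dotProduct, dotProduct_add] at *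
    linear_combination h1 + h2
  zero_mem' := by
    intro u v
    simp [form]
  smul_mem' := by
    intro c X hX u v
    have h1 := hX u v
    simp only [form, Matrix.smul_mulVec, Matrix.mulVec_smul, smul_dotProduct, dotProduct_smul,
      smul_eq_mul] at *
    linear_combination c * h1

/-- The component `𝔤^{k, -k}` of `𝔤`: it maps `H^{p, q}` to `H^{p + k, q - k}`. -/
def lieGraded (o : FiltrationSeq m) (k : ℤ) : Submodule ℂ (Matrix (Fin m) (Fin m) ℂ) where
  carrier := {X | X ∈ 𝓗.lieG ∧
    ∀ p : ℤ, ∀ v ∈ 𝓗.hodgePiece o p, X *ᵥ v ∈ 𝓗.hodgePiece o (p + k)}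
  add_mem' := by
    rintro X Y ⟨hX, hX'⟩ ⟨hY, hY'⟩
    refine ⟨add_mem hX hY, fun p v hv => ?_⟩
    rw [Matrix.add_mulVec]
    exact add_mem (hX' p v hv) (hY' p v hv)
  zero_mem' := ⟨zero_mem _, fun p v _ => by simp⟩
  smul_mem' := by
    rintro c X ⟨hX, hX'⟩
    refine ⟨Submodule.smul_mem _ c hX, fun p v hv => ?_⟩
    rw [Matrix.smul_mulVec]
    exact Submodule.smul_mem _ c (hX' p v hv)

/-- The nilpotent Lie algebra `𝔫₋`, the sum of the `𝔤^{-k, k}` over `k ≥ 1`. -/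
def lieNMinus (o : FiltrationSeq m) : Submodule ℂ (Matrix (Fin m) (Fin m) ℂ) :=
  ⨆ (k : ℕ) (_ : 1 ≤ k), 𝓗.lieGraded o (-(k : ℤ))

/-- The unipotent group `N₋ = exp 𝔫₋`. -/
def groupNMinus (o : FiltrationSeq m) : Set (Matrix (Fin m) (Fin m) ℂ) :=
  NormedSpace.exp '' (𝓗.lieNMinus o : Set (Matrix (Fin m) (Fin m) ℂ))

/-- `N₋`, identified with its orbit of the base point `o`. -/
def unipotentOrbit (o : FiltrationSeq m) : Set (FiltrationSeq m) :=
  {F | ∃ g ∈ 𝓗.groupNMinus o, F = o.act g}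

/-! ### Adapted bases and block leading principal minors -/

/-- A basis adapted to the Hodge filtration `F`: `F^k` is spanned by the first `f k` vectors. -/
def IsAdaptedToFiltration (F : FiltrationSeq m) (b : Module.Basis (Fin m) ℂ (Fin m → ℂ)) : Prop :=
  ∀ k ≤ 𝓗.weight, F k = Submodule.span ℂ (b '' {i | (i : ℕ) < 𝓗.f k})

/-- A basis adapted to the Hodge decomposition of `F`: `H^{k, n - k}` is spanned by the vectors
number `f (k + 1), …, f k - 1`. -/
def IsAdaptedToDecomposition (F : FiltrationSeq m)
    (b : Module.Basis (Fin m) ℂ (Fin m → ℂ)) : Prop :=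
  ∀ k ≤ 𝓗.weight,
    𝓗.hodgePiece F k = Submodule.span ℂ (b '' {i | 𝓗.f (k + 1) ≤ (i : ℕ) ∧ (i : ℕ) < 𝓗.f k})

/-- The transition matrix `A` with `ζ i = ∑ j, A i j • η j`. -/
def transitionMatrix (η ζ : Module.Basis (Fin m) ℂ (Fin m → ℂ)) : Matrix (Fin m) (Fin m) ℂ :=
  Matrix.of fun i j => η.repr (ζ i) j

/-- The block leading principal minor `det (A^{(α, β)})_{0 ≤ α, β ≤ k}`, where the `α`-th block of
indices is `f (n - α + 1) ≤ i < f (n - α)`; so the blocks `0, …, k` are the indices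
`i < f (n - k)`. -/
def blockMinor (A : Matrix (Fin m) (Fin m) ℂ) (k : ℕ) : ℂ :=
  (A.toSquareBlockProp fun i => (i : ℕ) < 𝓗.f (𝓗.weight - k)).det

/-! ### Period maps -/

/-- The arithmetic group `G_ℤ = Aut(H_ℤ, Q)`. -/
def GZ : Subgroup (GL (Fin m) ℤ) where
  carrier := {g | (g : Matrix (Fin m) (Fin m) ℤ)ᵀ * 𝓗.Q * (g : Matrix (Fin m) (Fin m) ℤ) = 𝓗.Q}
  mul_mem' := by
    intro a b ha hb
    simp only [Set.mem_ofPred_eq, Units.val_mul, Matrix.transpose_mul] at *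
    calc _ = (b : Matrix (Fin m) (Fin m) ℤ)ᵀ * ((a : Matrix (Fin m) (Fin m) ℤ)ᵀ * 𝓗.Q * a) * b := by
            simp only [Matrix.mul_assoc]
      _ = 𝓗.Q := by rw [ha, hb]
  one_mem' := by simp
  inv_mem' := by
    intro a ha
    simp only [Set.mem_ofPred_eq] at *
    have h1 : (a : Matrix (Fin m) (Fin m) ℤ) * ((a⁻¹ : GL (Fin m) ℤ) : Matrix _ _ ℤ) = 1 := by
      rw [← Units.val_mul, mul_inv_cancel, Units.val_one]
    have h2 : ((a⁻¹ : GL (Fin m) ℤ) : Matrix (Fin m) (Fin m) ℤ)ᵀ *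
        (a : Matrix (Fin m) (Fin m) ℤ)ᵀ = 1 := by
      rw [← Matrix.transpose_mul, h1, Matrix.transpose_one]
    conv_lhs => rw [← ha]
    calc _ = (((a⁻¹ : GL (Fin m) ℤ) : Matrix (Fin m) (Fin m) ℤ)ᵀ *
        (a : Matrix (Fin m) (Fin m) ℤ)ᵀ) * 𝓗.Q *
        ((a : Matrix (Fin m) (Fin m) ℤ) * ((a⁻¹ : GL (Fin m) ℤ) : Matrix _ _ ℤ)) := by
          simp only [Matrix.mul_assoc]
      _ = 𝓗.Q := by rw [h1, h2, Matrix.one_mul, Matrix.mul_one]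

/-- The equivalence relation on `D` whose classes are the orbits of `Γ`. -/
def orbitSetoid (Γ : Subgroup (GL (Fin m) ℤ)) : Setoid 𝓗.periodDomain where
  r F F' := ∃ γ ∈ Γ, (F' : FiltrationSeq m) =
    (F : FiltrationSeq m).act ((γ : Matrix (Fin m) (Fin m) ℤ).map (Int.cast : ℤ → ℂ))
  iseqv := by
    have hmul : ∀ (a b : GL (Fin m) ℤ) (F : FiltrationSeq m),
        (F.act ((a : Matrix (Fin m) (Fin m) ℤ).map (Int.cast : ℤ → ℂ))).act
          ((b : Matrix (Fin m) (Fin m) ℤ).map (Int.cast : ℤ → ℂ)) =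
        F.act (((b * a : GL (Fin m) ℤ) : Matrix (Fin m) (Fin m) ℤ).map (Int.cast : ℤ → ℂ)) := by
      intro a b F
      funext p
      have : ((b * a : GL (Fin m) ℤ) : Matrix (Fin m) (Fin m) ℤ).map (Int.cast : ℤ → ℂ) =
          (b : Matrix (Fin m) (Fin m) ℤ).map (Int.cast : ℤ → ℂ) *
          (a : Matrix (Fin m) (Fin m) ℤ).map (Int.cast : ℤ → ℂ) := by
        simpa using Matrix.map_mul (L := (b : Matrix (Fin m) (Fin m) ℤ))
          (M := (a : Matrix (Fin m) (Fin m) ℤ)) (f := Int.castRingHom ℂ)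
      simp only [FiltrationSeq.act]
      rw [this, Matrix.toLin'_mul, Submodule.map_comp]
    have hone : ∀ F : FiltrationSeq m,
        F.act (((1 : GL (Fin m) ℤ) : Matrix (Fin m) (Fin m) ℤ).map (Int.cast : ℤ → ℂ)) = F := by
      intro F
      funext p
      simp [FiltrationSeq.act]
    refine ⟨fun F => ⟨1, one_mem _, (hone _).symm⟩, ?_, ?_⟩
    · rintro F F' ⟨γ, hγ, h⟩
      exact ⟨γ⁻¹, inv_mem hγ, by rw [h, hmul, inv_mul_cancel, hone]⟩
    · rintro F F' F'' ⟨γ, hγ, h⟩ ⟨δ, hδ, h'⟩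
      exact ⟨δ * γ, mul_mem hδ hγ, by rw [h', h, hmul]⟩

/-- The quotient `Γ \ D`. -/
abbrev PeriodQuotient (Γ : Subgroup (GL (Fin m) ℤ)) : Type := Quotient (𝓗.orbitSetoid Γ)

section Maps

variable (E : Type*) [NormedAddCommGroup E] [NormedSpace ℂ E]
  {M : Type*} [TopologicalSpace M] [ChartedSpace E M]

/-- The map `φ : M → D` is holomorphic on `U`: every `z ↦ F^p_z` is a holomorphic subbundle of the
trivial bundle with fibre `H`, that is, it has local holomorphic frames. -/
def HolomorphicOn (φ : M → 𝓗.periodDomain) (U : Set M) : Prop :=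
  ∀ p ≤ 𝓗.weight, ∀ x ∈ U, ∃ V : Set M, IsOpen V ∧ x ∈ V ∧
    ∃ s : Fin (𝓗.f p) → M → (Fin m → ℂ),
      (∀ j, MDifferentiableOn 𝓘(ℂ, E) 𝓘(ℂ, Fin m → ℂ) (s j) V) ∧
      ∀ y ∈ V, LinearIndependent ℂ (fun j => s j y) ∧
        Submodule.span ℂ (Set.range fun j => s j y) = (φ y : FiltrationSeq m) p

/-- Griffiths transversality of `φ : M → D` on `U`: derivatives of local holomorphic sections of
`F^p` lie in `F^{p - 1}`. -/
def HorizontalOn (φ : M → 𝓗.periodDomain) (U : Set M) : Prop :=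
  ∀ p, 1 ≤ p → p ≤ 𝓗.weight → ∀ V : Set M, IsOpen V → V ⊆ U → ∀ s : M → (Fin m → ℂ),
    MDifferentiableOn 𝓘(ℂ, E) 𝓘(ℂ, Fin m → ℂ) s V →
    (∀ y ∈ V, s y ∈ (φ y : FiltrationSeq m) p) →
    ∀ y ∈ V, ∀ v : TangentSpace 𝓘(ℂ, E) y,
      (mfderiv 𝓘(ℂ, E) 𝓘(ℂ, Fin m → ℂ) s y v : Fin m → ℂ) ∈ (φ y : FiltrationSeq m) (p - 1)

/-- A period map `Φ : S → Γ \ D`: it has local lifts to `D` that are holomorphic and satisfy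
Griffiths transversality. -/
def IsPeriodMap (Γ : Subgroup (GL (Fin m) ℤ)) (Φ : M → 𝓗.PeriodQuotient Γ) : Prop :=
  ∀ x : M, ∃ U : Set M, IsOpen U ∧ x ∈ U ∧ ∃ φ : M → 𝓗.periodDomain,
    (∀ y ∈ U, (Quotient.mk (𝓗.orbitSetoid Γ) (φ y)) = Φ y) ∧
    𝓗.HolomorphicOn E φ U ∧ 𝓗.HorizontalOn E φ U

/-- `Ψ : T → D` is a lifted period map: a holomorphic map with `[Ψ(z)] = Φ(π(z))` in `Γ \ D`. -/
structure IsLiftedPeriodMap {S : Type*} {T : Type*} [TopologicalSpace T] [ChartedSpace E T]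
    (Γ : Subgroup (GL (Fin m) ℤ)) (π : T → S) (Φ : S → 𝓗.PeriodQuotient Γ)
    (Ψ : T → 𝓗.periodDomain) : Prop where
  lifts : ∀ z, Quotient.mk (𝓗.orbitSetoid Γ) (Ψ z) = Φ (π z)
  holomorphic : 𝓗.HolomorphicOn E Ψ Set.univ

end Maps

/-- The set `S^∨ = Φ⁻¹(N₋ ∩ D)` of a lifted period map with base point `z₀`, where `N₋` is formed
at the base point `o = Φ(z₀)`. -/
def veeLocus {T : Type*} (Ψ : T → 𝓗.periodDomain) (z₀ : T) : Set T :=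
  {z | (Ψ z : FiltrationSeq m) ∈ 𝓗.unipotentOrbit (Ψ z₀) ∩ 𝓗.periodDomain}

end HodgeData

end

/-!
Let `η` be a basis of `H` adapted to the Hodge decomposition of `o`, let `deg i` be the `p` with
`η i ∈ H^{p, n - p}`, and let `W p` (`lowerSpan`) be the span of the `η i` with `deg i < p`, which
is a complement of `o p`. Everything follows from a description of the orbit of `o` under
`N₋ = exp 𝔫₋` inside the compact dual: `F` lies in it if and only if `F p ∩ W p = 0` for all `p`
(`mem_unipotentOrbit_iff`).

An element of `𝔫₋` strictly lowers the degree, so its exponential preserves every `W p`, and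
`F p ∩ W p = 0` is inherited from `o`. Conversely, if `F p` is a complement of `W p` for all `p`,
send `η i` to the unique vector of `F (deg i)` congruent to `η i` modulo `W (deg i)`. This defines a
unipotent `g` with `g o = F`. It preserves `Q`: if `deg i + deg j > n`, both `Q(η i, η j)` and
`Q(g η i, g η j)` vanish by the first Hodge-Riemann relation, and otherwise the two differ by
pairings of components of total degree `< n`, which vanish by the conjugate relation for `o`. Its
logarithm `X` (`exists_exp_eq_one_add_of_pow_eq_zero`) lies in `𝔤`, since the polynomial
`t ↦ Q(exp(tX) u, exp(tX) v)` is constant on `ℕ` (`mem_lieG_of_exp_isometry`); the homogeneous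
components of `X` lie in `𝔤` as well (`gradedPart_mem_lieGraded`), so `X ∈ 𝔫₋`.

For a basis `ζ` adapted to `F`, the condition `F p ∩ W p = 0` says that the leading block of size
`f p` of the transition matrix is invertible (`blockMinor_ne_zero_iff`). Constant combinations of
local frames of the bundles `F^p` give a local holomorphic adapted basis
(`exists_holomorphic_adapted_basis`), so the complement of `S^∨` is locally the zero locus of the
product of the minors; in particular it is closed. A regular point of codimension zero would be
an interior point, and then the identity theorem on the connected manifold `S̃` would make the
complement all of `S̃` (`IsAnalyticSubvariety.eq_univ_of_interior_nonempty`), although the base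
point lies in `S^∨`.
-/

noncomputable section

/-! ### Degrees of indices -/

namespace HodgeData

variable {m : ℕ} (𝓗 : HodgeData m)

lemma f_zero : 𝓗.f 0 = m := by
  have h := 𝓗.h_sum
  rwa [Nat.range_succ_eq_Icc_zero] at h

lemma f_antitone : Antitone 𝓗.f := fun _ _ hpq =>
  Finset.sum_le_sum_of_subset (Finset.Icc_subset_Icc_left hpq)

lemma f_eq_zero {p : ℕ} (hp : 𝓗.weight < p) : 𝓗.f p = 0 := by
  rw [f, Finset.Icc_eq_empty (by omega), Finset.sum_empty]

/-- The degree of the index `i`: the number `p` with `f (p + 1) ≤ i < f p`, so that the `i`-th vector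
of a basis adapted to a Hodge decomposition lies in `H^{p, n - p}`. -/
def degree (i : Fin m) : ℕ := Nat.findGreatest (fun p => (i : ℕ) < 𝓗.f p) 𝓗.weight

lemma degree_le (i : Fin m) : 𝓗.degree i ≤ 𝓗.weight := Nat.findGreatest_le _

lemma le_degree_iff {p : ℕ} {i : Fin m} : p ≤ 𝓗.degree i ↔ (i : ℕ) < 𝓗.f p := by
  constructor
  · intro h
    have h0 : (i : ℕ) < 𝓗.f (𝓗.degree i) :=
      Nat.findGreatest_spec (P := fun p => (i : ℕ) < 𝓗.f p) (Nat.zero_le _)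
        (by rw [f_zero]; exact i.2)
    exact h0.trans_le (𝓗.f_antitone h)
  · intro h
    refine Nat.le_findGreatest ?_ h
    by_contra hp
    rw [𝓗.f_eq_zero (by omega)] at h
    omega

lemma degree_eq_iff {p : ℕ} {i : Fin m} :
    𝓗.degree i = p ↔ 𝓗.f (p + 1) ≤ (i : ℕ) ∧ (i : ℕ) < 𝓗.f p := by
  rw [← le_degree_iff, ← not_lt, ← le_degree_iff]
  omega

lemma f_le (p : ℕ) : 𝓗.f p ≤ m := by
  simpa [f_zero] using 𝓗.f_antitone (Nat.zero_le p)

lemma card_le_degree (p : ℕ) : Fintype.card {i : Fin m // p ≤ 𝓗.degree i} = 𝓗.f p := by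
  simp only [le_degree_iff]
  rw [Fintype.card_subtype]
  have := 𝓗.f_le p
  simp [Fin.card_filter_val_lt, this]

/-! ### Bilinearity and orthogonality -/

/-- The polarization form `form`, bundled as a bilinear form. -/
def formB : LinearMap.BilinForm ℂ (Fin m → ℂ) := Matrix.toBilin' (𝓗.Q.map (Int.cast : ℤ → ℂ))

lemma formB_apply (u v : Fin m → ℂ) : 𝓗.formB u v = 𝓗.form u v := by
  rw [formB, Matrix.toBilin'_apply', form]

lemma form_star (u v : Fin m → ℂ) : 𝓗.form (star u) (star v) = star (𝓗.form u v) := by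
  simp [form, dotProduct, Matrix.mulVec]

lemma form_eq_zero_of_mem_span {s t : Set (Fin m → ℂ)} (h : ∀ x ∈ s, ∀ y ∈ t, 𝓗.form x y = 0)
    {u v : Fin m → ℂ} (hu : u ∈ Submodule.span ℂ s) (hv : v ∈ Submodule.span ℂ t) :
    𝓗.form u v = 0 := by
  simp only [← formB_apply] at *
  induction hu, hv using Submodule.span_induction₂ with
  | mem_mem x y hx hy => exact h x hx y hy
  | zero_left => simp
  | zero_right => simp
  | add_left x y z _ _ _ h1 h2 => simp [h1, h2]
  | add_right x y z _ _ _ h1 h2 => simp [h1, h2]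
  | smul_left r x y _ _ h1 => simp [h1]
  | smul_right r x y _ _ h1 => simp [h1]

/-! ### Hodge decompositions and adapted bases -/

variable {𝓗} {F o : FiltrationSeq m} {η : Module.Basis (Fin m) ℂ (Fin m → ℂ)}

lemma finrank_eq_f (hF : F ∈ 𝓗.compactDual) (p : ℕ) : Module.finrank ℂ (F p) = 𝓗.f p := by
  by_cases hp : p ≤ 𝓗.weight
  · exact hF.2.2.2.1 p hp
  · rw [hF.2.2.1 p (by omega), finrank_bot, 𝓗.f_eq_zero (by omega)]

lemma form_eq_zero_of_mem (hF : F ∈ 𝓗.compactDual) {p q : ℕ} (hpq : 𝓗.weight < p + q)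
    {u v : Fin m → ℂ} (hu : u ∈ F p) (hv : v ∈ F q) : 𝓗.form u v = 0 := by
  by_cases hp : p ≤ 𝓗.weight
  · exact hF.2.2.2.2 p hp u hu v (hF.2.1 (by omega) hv)
  · rw [hF.2.2.1 p (by omega), Submodule.mem_bot] at hu
    simp [hu, form]

lemma mem_conjSubspace {V : Submodule ℂ (Fin m → ℂ)} {v : Fin m → ℂ} :
    v ∈ conjSubspace V ↔ star v ∈ V := Iff.rfl

lemma hodgePiece_natCast {p : ℕ} (hp : p ≤ 𝓗.weight) :
    𝓗.hodgePiece F p = F p ⊓ conjSubspace (F (𝓗.weight - p)) := by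
  rw [hodgePiece]
  congr
  omega

lemma hodgePiece_eq_bot (hF : F ∈ 𝓗.compactDual) {p : ℤ} (hp : p < 0 ∨ 𝓗.weight < p) :
    𝓗.hodgePiece F p = ⊥ := by
  rw [hodgePiece, eq_bot_iff]
  rintro v ⟨hv1, hv2⟩
  rcases hp with hp | hp
  · rw [SetLike.mem_coe, mem_conjSubspace, hF.2.2.1 _ (by omega)] at hv2
    simpa using hv2
  · rwa [SetLike.mem_coe, hF.2.2.1 _ (by omega)] at hv1

/-- `H^{p, n - p}` and `H^{q, n - q}` with `p + q ≠ n` are orthogonal: if `p + q > n` because of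
the first Hodge-Riemann relation, and if `p + q < n` because of its complex conjugate. -/
lemma form_hodgePiece_eq_zero (hF : F ∈ 𝓗.compactDual) {p q : ℕ} (hp : p ≤ 𝓗.weight)
    (hq : q ≤ 𝓗.weight) (hpq : p + q ≠ 𝓗.weight) {u v : Fin m → ℂ} (hu : u ∈ 𝓗.hodgePiece F p)
    (hv : v ∈ 𝓗.hodgePiece F q) : 𝓗.form u v = 0 := by
  rw [hodgePiece_natCast hp] at hu
  rw [hodgePiece_natCast hq] at hv
  rcases lt_or_gt_of_ne hpq with h | h
  · rw [← star_eq_zero, ← form_star]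
    exact form_eq_zero_of_mem hF (by omega) hu.2 hv.2
  · exact form_eq_zero_of_mem hF h hu.1 hv.1

/-- `F^p = H^{p, n - p} ⊕ F^{p + 1}`: decompose a vector of `F^p` along
`H = F^{p + 1} ⊕ conj F^{n - p}`. -/
lemma sup_hodgePiece (hF : F ∈ 𝓗.periodDomain) {p : ℕ} (hp : p ≤ 𝓗.weight) :
    𝓗.hodgePiece F p ⊔ F (p + 1) = F p := by
  have hanti := hF.1.2.1
  rw [hodgePiece_natCast hp]
  refine le_antisymm (sup_le inf_le_left (hanti (Nat.le_succ p))) fun v hv => ?_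
  have htop : F (p + 1) ⊔ conjSubspace (F (𝓗.weight - p)) = ⊤ := by
    by_cases hp' : p + 1 ≤ 𝓗.weight
    · have := (hF.2.1 (p + 1) hp').sup_eq_top
      rwa [Nat.add_sub_add_right] at this
    · rw [eq_top_iff, show 𝓗.weight - p = 0 by omega, hF.1.1]
      intro x _
      exact Submodule.mem_sup_right (by simp [mem_conjSubspace])
  obtain ⟨a, ha, b, hb, rfl⟩ := Submodule.mem_sup.1 (htop ▸ Submodule.mem_top : v ∈ _)
  refine Submodule.mem_sup.2 ⟨b, ⟨?_, hb⟩, a, ha, add_comm _ _⟩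
  simpa using sub_mem hv (hanti (Nat.le_succ p) ha)

lemma disjoint_hodgePiece (hF : F ∈ 𝓗.periodDomain) {p : ℕ} (hp : p ≤ 𝓗.weight) :
    Disjoint (𝓗.hodgePiece F p) (F (p + 1)) := by
  rw [hodgePiece_natCast hp]
  by_cases hp' : p + 1 ≤ 𝓗.weight
  · have := (hF.2.1 (p + 1) hp').disjoint.symm
    rw [Nat.add_sub_add_right] at this
    exact this.mono_left inf_le_right
  · rw [hF.1.2.2.1 (p + 1) (by omega)]
    exact disjoint_bot_right

lemma finrank_hodgePiece (hF : F ∈ 𝓗.periodDomain) {p : ℕ} (hp : p ≤ 𝓗.weight) :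
    Module.finrank ℂ (𝓗.hodgePiece F p) = Fintype.card {i : Fin m // 𝓗.degree i = p} := by
  have h1 := Submodule.finrank_sup_add_finrank_inf_eq (𝓗.hodgePiece F p) (F (p + 1))
  rw [sup_hodgePiece hF hp, (disjoint_hodgePiece hF hp).eq_bot, finrank_bot,
    finrank_eq_f hF.1, finrank_eq_f hF.1] at h1
  have h2 := 𝓗.card_le_degree p
  have h3 := 𝓗.card_le_degree (p + 1)
  rw [Fintype.card_subtype] at *
  have h4 : Finset.univ.filter (fun i : Fin m => p ≤ 𝓗.degree i) =
      Finset.univ.filter (fun i : Fin m => 𝓗.degree i = p) ∪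
      Finset.univ.filter (fun i : Fin m => p + 1 ≤ 𝓗.degree i) := by
    ext i; simp; omega
  rw [h4, Finset.card_union_of_disjoint] at h2
  · omega
  · rw [Finset.disjoint_filter]; intros; omega

/-- The Hodge filtration is the sum of the Hodge components of larger degree. -/
lemma eq_iSup_hodgePiece (hF : F ∈ 𝓗.periodDomain) (p : ℕ) :
    F p = ⨆ k : {k : ℕ // p ≤ k}, 𝓗.hodgePiece F (k : ℕ) := by
  apply le_antisymm
  · by_cases hp : 𝓗.weight < p
    · rw [hF.1.2.2.1 p hp]; exact bot_le
    push Not at hp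
    refine Nat.decreasingInduction' (P := fun q => F q ≤ ⨆ k : {k : ℕ // p ≤ k}, 𝓗.hodgePiece F (k : ℕ))
      (m := p) (n := 𝓗.weight + 1) ?_ (by omega) ?_
    · intro k hk hpk ih
      rw [← sup_hodgePiece hF (by omega : k ≤ 𝓗.weight)]
      exact sup_le (le_iSup (fun k : {k : ℕ // p ≤ k} => 𝓗.hodgePiece F (k : ℕ)) ⟨k, hpk⟩) ih
    · rw [hF.1.2.2.1 _ (Nat.lt_succ_self _)]; exact bot_le
  · refine iSup_le fun k => ?_
    refine le_trans ?_ (hF.1.2.1 k.2)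
    rw [hodgePiece]
    exact inf_le_left.trans (by simp)

/-- A basis adapted to the Hodge decomposition exists: bases of the Hodge components, indexed by
the fibres of `degree`, together span `H`. -/
lemma exists_isAdaptedToDecomposition (hF : F ∈ 𝓗.periodDomain) :
    ∃ η, 𝓗.IsAdaptedToDecomposition F η := by
  have hb : ∀ p : ℕ, p ≤ 𝓗.weight → Nonempty
      (Module.Basis {i : Fin m // 𝓗.degree i = p} ℂ (𝓗.hodgePiece F p)) := fun p hp =>
    ⟨Module.Basis.reindex (Module.finBasis ℂ _)
      (Fintype.equivOfCardEq (by rw [Fintype.card_fin, finrank_hodgePiece hF hp]))⟩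
  let b := fun p hp => (hb p hp).some
  let v : Fin m → (Fin m → ℂ) := fun i => b (𝓗.degree i) (𝓗.degree_le i) ⟨i, rfl⟩
  have hspan : ∀ p : ℕ, p ≤ 𝓗.weight →
      𝓗.hodgePiece F p = Submodule.span ℂ (v '' {i | 𝓗.degree i = p}) := by
    intro p hp
    have h1 := congrArg (Submodule.map (𝓗.hodgePiece F p).subtype) (b p hp).span_eq
    rw [Submodule.map_span, Submodule.map_top, Submodule.range_subtype] at h1
    rw [← h1, ← Set.range_comp]
    congr 1
    ext x
    constructor
    · rintro ⟨⟨i, rfl⟩, rfl⟩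
      exact ⟨i, rfl, rfl⟩
    · rintro ⟨i, rfl, rfl⟩
      exact ⟨⟨i, rfl⟩, rfl⟩
  have htop : ⊤ ≤ Submodule.span ℂ (Set.range v) := by
    rw [← hF.1.1, eq_iSup_hodgePiece hF]
    refine iSup_le fun k => ?_
    by_cases hk : (k : ℕ) ≤ 𝓗.weight
    · rw [hspan _ hk]
      exact Submodule.span_mono (Set.image_subset_range _ _)
    · rw [hodgePiece_eq_bot hF.1 (by omega)]
      exact bot_le
  refine ⟨basisOfTopLeSpanOfCardEqFinrank v htop (by simp), fun k hk => ?_⟩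
  rw [coe_basisOfTopLeSpanOfCardEqFinrank, hspan k hk]
  simp only [degree_eq_iff]

lemma IsAdaptedToDecomposition.hodgePiece_eq (hη : 𝓗.IsAdaptedToDecomposition F η)
    (hF : F ∈ 𝓗.compactDual) (p : ℤ) :
    𝓗.hodgePiece F p = Submodule.span ℂ (η '' {i | (𝓗.degree i : ℤ) = p}) := by
  by_cases hp : p < 0 ∨ 𝓗.weight < p
  · rw [hodgePiece_eq_bot hF hp]
    have : {i | (𝓗.degree i : ℤ) = p} = ∅ := by
      ext i
      have := 𝓗.degree_le i
      simp
      omega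
    simp [this]
  · lift p to ℕ using by omega
    rw [hη p (by omega)]
    simp only [← degree_eq_iff, Nat.cast_inj]

lemma IsAdaptedToDecomposition.mem_hodgePiece (hη : 𝓗.IsAdaptedToDecomposition F η)
    (hF : F ∈ 𝓗.compactDual) (i : Fin m) : η i ∈ 𝓗.hodgePiece F (𝓗.degree i) := by
  rw [hη.hodgePiece_eq hF]
  exact Submodule.subset_span ⟨i, rfl, rfl⟩

lemma IsAdaptedToDecomposition.filtration_eq (hη : 𝓗.IsAdaptedToDecomposition F η)
    (hF : F ∈ 𝓗.periodDomain) (p : ℕ) :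
    F p = Submodule.span ℂ (η '' {i | p ≤ 𝓗.degree i}) := by
  rw [eq_iSup_hodgePiece hF]
  simp only [hη.hodgePiece_eq hF.1]
  rw [← Submodule.span_iUnion]
  congr 1
  ext x
  simp

lemma IsAdaptedToDecomposition.form_eq_zero (hη : 𝓗.IsAdaptedToDecomposition F η)
    (hF : F ∈ 𝓗.compactDual) {i j : Fin m} (hij : 𝓗.degree i + 𝓗.degree j ≠ 𝓗.weight) :
    𝓗.form (η i) (η j) = 0 :=
  form_hodgePiece_eq_zero hF (𝓗.degree_le i) (𝓗.degree_le j) hij (hη.mem_hodgePiece hF i)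
    (hη.mem_hodgePiece hF j)

end HodgeData

/-! ### Exponentials of nilpotent elements -/

section Exponential

open NormedSpace Nat

variable {𝔸 : Type*} [NormedRing 𝔸] [NormedAlgebra ℂ 𝔸] [CompleteSpace 𝔸]

/-- The derivative of `exp` along a curve of commuting elements. -/
lemma hasDerivAt_exp_of_commute {γ : ℂ → 𝔸} {γ' : 𝔸} {t : ℂ} (hγ : HasDerivAt γ γ' t)
    (hcomm : ∀ s, Commute (γ t) (γ s)) :
    HasDerivAt (fun s => exp (γ s)) (exp (γ t) * γ') t := by
  let _ : NormedAlgebra ℚ 𝔸 := NormedAlgebra.restrictScalars ℚ ℂ 𝔸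
  have h1 : HasDerivAt (fun s => γ s - γ t) γ' t := hγ.sub_const _
  have h2 : HasFDerivAt (exp : 𝔸 → 𝔸) (1 : 𝔸 →L[ℂ] 𝔸) (γ t - γ t) := by
    rw [sub_self]; exact hasFDerivAt_exp_zero
  have h3 := (h2.comp_hasDerivAt t h1).const_mul (exp (γ t))
  refine h3.congr_of_eventuallyEq (Filter.Eventually.of_forall fun s => ?_)
  simp only [Function.comp]
  rw [← exp_add_of_commute ((hcomm s).sub_right (Commute.refl _)), add_sub_cancel]

/-- The truncated logarithm series of a nilpotent element `N` is a logarithm of `1 + N`. With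
`L(t)` the series at `t N`, the curve `exp(-L(t)) (1 + t N)` has derivative zero. -/
lemma exists_exp_eq_one_add_of_pow_eq_zero {N : 𝔸} {k : ℕ} (hN : N ^ k = 0) :
    ∃ c : ℕ → ℂ, exp (∑ j ∈ Finset.range k, c j • N ^ (j + 1)) = 1 + N := by
  let _ : NormedAlgebra ℚ 𝔸 := NormedAlgebra.restrictScalars ℚ ℂ 𝔸
  let L : ℂ → 𝔸 := fun t =>
    ∑ j ∈ Finset.range k, (t ^ (j + 1) * ((-1) ^ j / ((j : ℂ) + 1))) • N ^ (j + 1)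
  let L' : ℂ → 𝔸 := fun t => ∑ j ∈ Finset.range k, ((-t) ^ j) • N ^ (j + 1)
  have hcommN : ∀ t, Commute (L t) N := fun t => Commute.sum_left _ _ _ fun j _ =>
    (Commute.pow_left (Commute.refl N) _).smul_left _
  have hcomm : ∀ s t, Commute (L t) (L s) := fun s t => Commute.sum_right _ _ _ fun j _ =>
    ((hcommN t).pow_right _).smul_right _
  have hL : ∀ t, HasDerivAt L (L' t) t := by
    intro t
    refine HasDerivAt.fun_sum fun j _ => ?_
    refine HasDerivAt.smul_const ?_ _
    convert! (hasDerivAt_pow (j + 1) t).mul_const ((-1 : ℂ) ^ j / ((j : ℂ) + 1)) using 1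
    have : (j : ℂ) + 1 ≠ 0 := by exact_mod_cast j.succ_ne_zero
    rw [neg_pow]
    push_cast
    field_simp
  -- The geometric series: `L'(t) = N (1 + t N)⁻¹`.
  have hL' : ∀ t, L' t * (1 + t • N) = N := by
    intro t
    have h1 : L' t = N * ∑ i ∈ Finset.range k, (-(t • N)) ^ i := by
      simp only [L', Finset.mul_sum]
      refine Finset.sum_congr rfl fun j _ => ?_
      rw [← neg_smul, smul_pow, mul_smul_comm, _root_.pow_succ']
    have h2 := geom_sum_mul_neg (-(t • N)) k
    rw [h1, mul_assoc, ← sub_neg_eq_add, h2, ← neg_smul, smul_pow, hN]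
    simp
  have hderiv : ∀ t, HasDerivAt (fun s => exp (-L s) * (1 + s • N)) 0 t := by
    intro t
    have h1 : HasDerivAt (fun s => exp (-L s)) (exp (-L t) * -L' t) t :=
      hasDerivAt_exp_of_commute (hL t).neg fun s => ((hcomm s t).neg_left).neg_right
    have h2 : HasDerivAt (fun s : ℂ => 1 + s • N) N t := by
      simpa using ((hasDerivAt_id t).smul_const N).const_add 1
    convert! h1.mul h2 using 1
    rw [mul_assoc, neg_mul, hL', mul_neg, neg_add_cancel]
  have hconst := is_const_of_deriv_eq_zero (fun t => (hderiv t).differentiableAt)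
    (fun t => (hderiv t).deriv) 1 0
  refine ⟨fun j => (-1) ^ j / ((j : ℂ) + 1), ?_⟩
  have hL0 : L 0 = 0 := Finset.sum_eq_zero fun j _ => by simp
  have hL1 : L 1 = ∑ j ∈ Finset.range k, ((-1) ^ j / ((j : ℂ) + 1)) • N ^ (j + 1) :=
    Finset.sum_congr rfl fun j _ => by simp
  rw [hL0, hL1] at hconst
  simp only [neg_zero, exp_zero, one_smul, zero_smul, add_zero, mul_one] at hconst
  set S := ∑ j ∈ Finset.range k, ((-1) ^ j / ((j : ℂ) + 1)) • N ^ (j + 1)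
  calc exp S = exp S * (exp (-S) * (1 + N)) := by rw [hconst, mul_one]
    _ = 1 + N := by
      rw [← mul_assoc, ← exp_add_of_commute (Commute.neg_right (Commute.refl S)), add_neg_cancel,
        exp_zero, one_mul]

lemma exp_eq_sum_of_pow_eq_zero {X : 𝔸} {k : ℕ} (hX : X ^ k = 0) :
    exp X = ∑ j ∈ Finset.range k, ((j ! : ℂ)⁻¹) • X ^ j := by
  refine (exp_series_hasSum_exp' (𝕂 := ℂ) X).unique (hasSum_sum_of_ne_finset_zero fun j hj => ?_)
  rw [pow_eq_zero_of_le (by simpa using hj) hX, smul_zero]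

end Exponential

section Matrix

open scoped Matrix.Norms.Operator
open NormedSpace

variable {m : ℕ}

-- Matrices carry no global norm; the exponential depends only on the topology, which every matrix
-- norm induces, so one is chosen locally.
lemma Matrix.exists_exp_eq_one_add_of_pow_eq_zero {N : Matrix (Fin m) (Fin m) ℂ} {k : ℕ}
    (hN : N ^ k = 0) :
    ∃ c : ℕ → ℂ, exp (∑ j ∈ Finset.range k, c j • N ^ (j + 1)) = 1 + N :=
  _root_.exists_exp_eq_one_add_of_pow_eq_zero hN

lemma Matrix.exp_eq_sum_of_pow_eq_zero {X : Matrix (Fin m) (Fin m) ℂ} {k : ℕ} (hX : X ^ k = 0) :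
    exp X = ∑ j ∈ Finset.range k, ((j.factorial : ℂ)⁻¹) • X ^ j :=
  _root_.exp_eq_sum_of_pow_eq_zero hX

end Matrix

namespace HodgeData

variable {m : ℕ} {𝓗 : HodgeData m} {F o : FiltrationSeq m}
  {η ζ : Module.Basis (Fin m) ℂ (Fin m → ℂ)}

/-! ### Endomorphisms lowering the Hodge degree -/

lemma matrix_ext_basis (η : Module.Basis (Fin m) ℂ (Fin m → ℂ)) {X Y : Matrix (Fin m) (Fin m) ℂ}
    (h : ∀ i, X *ᵥ η i = Y *ᵥ η i) : X = Y :=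
  Matrix.toLin'.injective (η.ext fun i => by simpa using h i)

lemma mem_span_image_iff {s : Set (Fin m)} {v : Fin m → ℂ} :
    v ∈ Submodule.span ℂ (η '' s) ↔ ∀ i ∉ s, η.repr v i = 0 := by
  rw [Module.Basis.mem_span_image]
  constructor
  · intro h i hi
    by_contra h0
    exact hi (h (by simpa using h0))
  · intro h i hi
    by_contra h0
    exact (by simpa using hi : ¬ η.repr v i = 0) (h i h0)

variable (𝓗 η) in
/-- The sum of the Hodge components of degree less than `p`, for a basis `η` adapted to the
decomposition. -/
def lowerSpan (p : ℕ) : Submodule ℂ (Fin m → ℂ) :=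
  Submodule.span ℂ (η '' {i | 𝓗.degree i < p})

lemma lowerSpan_mono : Monotone (𝓗.lowerSpan η) := fun _ _ hpq =>
  Submodule.span_mono (Set.image_mono fun _ hi => lt_of_lt_of_le hi hpq)

lemma mem_lowerSpan {p : ℕ} {v : Fin m → ℂ} :
    v ∈ 𝓗.lowerSpan η p ↔ ∀ i, p ≤ 𝓗.degree i → η.repr v i = 0 := by
  rw [lowerSpan, mem_span_image_iff]
  simp

lemma basis_mem_lowerSpan {p : ℕ} {i : Fin m} (h : 𝓗.degree i < p) : η i ∈ 𝓗.lowerSpan η p :=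
  Submodule.subset_span ⟨i, h, rfl⟩

variable (𝓗 η) in
/-- The matrices that strictly lower the Hodge degree. -/
def lowering : Submodule ℂ (Matrix (Fin m) (Fin m) ℂ) where
  carrier := {X | ∀ p, ∀ v ∈ 𝓗.lowerSpan η (p + 1), X *ᵥ v ∈ 𝓗.lowerSpan η p}
  add_mem' hX hY p v hv := by
    rw [Matrix.add_mulVec]
    exact add_mem (hX p v hv) (hY p v hv)
  zero_mem' p v _ := by simp
  smul_mem' c X hX p v hv := by
    rw [Matrix.smul_mulVec]
    exact Submodule.smul_mem _ c (hX p v hv)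

lemma mem_lowering_iff {X : Matrix (Fin m) (Fin m) ℂ} :
    X ∈ 𝓗.lowering η ↔ ∀ i, X *ᵥ η i ∈ 𝓗.lowerSpan η (𝓗.degree i) := by
  refine ⟨fun h i => h _ _ (basis_mem_lowerSpan (Nat.lt_succ_self _)), fun h p v hv => ?_⟩
  suffices 𝓗.lowerSpan η (p + 1) ≤ (𝓗.lowerSpan η p).comap (Matrix.toLin' X) by
    simpa using this hv
  rw [lowerSpan, Submodule.span_le]
  rintro _ ⟨i, hi, rfl⟩
  simpa using lowerSpan_mono (Nat.le_of_lt_succ hi) (h i)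

lemma mulVec_mem_lowerSpan {X : Matrix (Fin m) (Fin m) ℂ} (hX : X ∈ 𝓗.lowering η) {p : ℕ}
    {v : Fin m → ℂ} (hv : v ∈ 𝓗.lowerSpan η p) : X *ᵥ v ∈ 𝓗.lowerSpan η p :=
  hX p v (lowerSpan_mono (Nat.le_succ p) hv)

lemma mul_mem_lowering {X Y : Matrix (Fin m) (Fin m) ℂ} (hX : X ∈ 𝓗.lowering η)
    (hY : Y ∈ 𝓗.lowering η) : X * Y ∈ 𝓗.lowering η := fun p v hv => by
  rw [← Matrix.mulVec_mulVec]
  exact mulVec_mem_lowerSpan hX (hY p v hv)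

lemma pow_succ_mem_lowering {X : Matrix (Fin m) (Fin m) ℂ} (hX : X ∈ 𝓗.lowering η) (k : ℕ) :
    X ^ (k + 1) ∈ 𝓗.lowering η := by
  induction k with
  | zero => simpa using hX
  | succ k ih => exact pow_succ X (k + 1) ▸ mul_mem_lowering ih hX

lemma pow_eq_zero_of_mem_lowering {X : Matrix (Fin m) (Fin m) ℂ} (hX : X ∈ 𝓗.lowering η) :
    X ^ (𝓗.weight + 1) = 0 := by
  have key : ∀ k, ∀ v ∈ 𝓗.lowerSpan η k, X ^ k *ᵥ v = 0 := by
    intro k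
    induction k with
    | zero => intro v hv; simpa [lowerSpan] using hv
    | succ k ih =>
      intro v hv
      rw [pow_succ, ← Matrix.mulVec_mulVec]
      exact ih _ (hX k v hv)
  refine matrix_ext_basis η fun i => ?_
  rw [key _ _ (basis_mem_lowerSpan (Nat.lt_succ_of_le (𝓗.degree_le i))), Matrix.zero_mulVec]

lemma exp_sub_one_mem_lowering {X : Matrix (Fin m) (Fin m) ℂ} (hX : X ∈ 𝓗.lowering η) :
    NormedSpace.exp X - 1 ∈ 𝓗.lowering η := by
  rw [Matrix.exp_eq_sum_of_pow_eq_zero (pow_eq_zero_of_mem_lowering hX), Finset.sum_range_succ']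
  simp only [Nat.factorial_zero, Nat.cast_one, inv_one, pow_zero, one_smul, add_sub_cancel_right]
  exact Submodule.sum_mem _ fun j _ => Submodule.smul_mem _ _ (pow_succ_mem_lowering hX j)

lemma exp_mulVec_mem_lowerSpan {X : Matrix (Fin m) (Fin m) ℂ} (hX : X ∈ 𝓗.lowering η) {p : ℕ}
    {v : Fin m → ℂ} (hv : v ∈ 𝓗.lowerSpan η p) : NormedSpace.exp X *ᵥ v ∈ 𝓗.lowerSpan η p := by
  have := add_mem (mulVec_mem_lowerSpan (exp_sub_one_mem_lowering hX) hv) hv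
  rwa [Matrix.sub_mulVec, Matrix.one_mulVec, sub_add_cancel] at this

lemma exists_exp_eq_of_mem_lowering {N : Matrix (Fin m) (Fin m) ℂ} (hN : N ∈ 𝓗.lowering η) :
    ∃ X ∈ 𝓗.lowering η, NormedSpace.exp X = 1 + N := by
  obtain ⟨c, hc⟩ := Matrix.exists_exp_eq_one_add_of_pow_eq_zero (pow_eq_zero_of_mem_lowering hN)
  exact ⟨_, Submodule.sum_mem _ fun j _ => Submodule.smul_mem _ _ (pow_succ_mem_lowering hN j), hc⟩

/-! ### The nilpotent Lie algebra and its exponential -/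

lemma lieNMinus_le_lowering (ho : o ∈ 𝓗.compactDual) (hη : 𝓗.IsAdaptedToDecomposition o η) :
    𝓗.lieNMinus o ≤ 𝓗.lowering η := by
  refine iSup₂_le fun k hk X hX => mem_lowering_iff.2 fun i => ?_
  have h := hX.2 _ _ (hη.mem_hodgePiece ho i)
  rw [hη.hodgePiece_eq ho] at h
  refine Submodule.span_mono (Set.image_mono fun j hj => ?_) h
  simp only [Set.mem_ofPred_eq] at hj ⊢
  omega

lemma mem_lieG_of_basis {X : Matrix (Fin m) (Fin m) ℂ}
    (h : ∀ i j, 𝓗.form (X *ᵥ η i) (η j) + 𝓗.form (η i) (X *ᵥ η j) = 0) : X ∈ 𝓗.lieG := by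
  intro u v
  have h0 : 𝓗.formB.compLeft (Matrix.toLin' X) + 𝓗.formB.compRight (Matrix.toLin' X) = 0 :=
    LinearMap.BilinForm.ext_basis η fun i j => by simpa [formB_apply] using h i j
  simpa [formB_apply] using congrArg (fun B => B u v) h0

variable (𝓗 η) in
/-- The homogeneous component of degree `-k` of a matrix, with respect to the grading of `H` by the
degrees of the basis vectors `η i`. -/
def gradedPart (X : Matrix (Fin m) (Fin m) ℂ) (k : ℕ) : Matrix (Fin m) (Fin m) ℂ :=
  LinearMap.toMatrix' (η.constr ℂ fun j =>
    ∑ i, if 𝓗.degree i + k = 𝓗.degree j then η.repr (X *ᵥ η j) i • η i else 0)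

lemma gradedPart_mulVec (X : Matrix (Fin m) (Fin m) ℂ) (k : ℕ) (j : Fin m) :
    𝓗.gradedPart η X k *ᵥ η j =
      ∑ i, if 𝓗.degree i + k = 𝓗.degree j then η.repr (X *ᵥ η j) i • η i else 0 := by
  rw [gradedPart, LinearMap.toMatrix'_mulVec, Module.Basis.constr_basis]

/-- A lowering matrix has homogeneous components in the degrees `-1, …, -n` only. -/
lemma sum_gradedPart {X : Matrix (Fin m) (Fin m) ℂ} (hX : X ∈ 𝓗.lowering η) :
    ∑ k ∈ Finset.Icc 1 𝓗.weight, 𝓗.gradedPart η X k = X := by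
  refine matrix_ext_basis η fun j => ?_
  rw [Matrix.sum_mulVec]
  simp only [gradedPart_mulVec]
  rw [Finset.sum_comm]
  conv_rhs => rw [← η.sum_repr (X *ᵥ η j)]
  refine Finset.sum_congr rfl fun i _ => ?_
  by_cases hij : 𝓗.degree i < 𝓗.degree j
  · have := 𝓗.degree_le j
    rw [Finset.sum_eq_single_of_mem (𝓗.degree j - 𝓗.degree i) (by simp; omega)
      fun k _ hk => if_neg (by omega), if_pos (by omega)]
  · rw [mem_lowerSpan.1 (mem_lowering_iff.1 hX j) i (not_lt.1 hij)]
    simp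

/-- Pairing with `η b` picks the component of `X (η a)` of degree `n - deg b`. -/
lemma form_gradedPart_left (ho : o ∈ 𝓗.compactDual) (hη : 𝓗.IsAdaptedToDecomposition o η)
    (X : Matrix (Fin m) (Fin m) ℂ) (k : ℕ) (a b : Fin m) :
    𝓗.form (𝓗.gradedPart η X k *ᵥ η a) (η b) =
      if 𝓗.degree a + 𝓗.degree b = 𝓗.weight + k then 𝓗.form (X *ᵥ η a) (η b) else 0 := by
  have h0 : ∀ i, 𝓗.degree i + 𝓗.degree b ≠ 𝓗.weight → 𝓗.formB (η i) (η b) = 0 := fun i hi => by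
    rw [formB_apply, hη.form_eq_zero ho hi]
  conv_rhs => rw [← η.sum_repr (X *ᵥ η a)]
  rw [gradedPart_mulVec]
  simp only [← formB_apply, map_sum, LinearMap.sum_apply, map_smul, LinearMap.smul_apply]
  split_ifs with hab
  · refine Finset.sum_congr rfl fun i _ => ?_
    split_ifs with hi
    · simp
    · rw [h0 i (by omega)]
      simp
  · refine Finset.sum_eq_zero fun i _ => ?_
    split_ifs with hi
    · rw [map_smul, LinearMap.smul_apply, h0 i (by omega), smul_zero]
    · simp

lemma form_gradedPart_right (ho : o ∈ 𝓗.compactDual) (hη : 𝓗.IsAdaptedToDecomposition o η)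
    (X : Matrix (Fin m) (Fin m) ℂ) (k : ℕ) (a b : Fin m) :
    𝓗.form (η a) (𝓗.gradedPart η X k *ᵥ η b) =
      if 𝓗.degree a + 𝓗.degree b = 𝓗.weight + k then 𝓗.form (η a) (X *ᵥ η b) else 0 := by
  have h0 : ∀ i, 𝓗.degree a + 𝓗.degree i ≠ 𝓗.weight → 𝓗.formB (η a) (η i) = 0 := fun i hi => by
    rw [formB_apply, hη.form_eq_zero ho hi]
  conv_rhs => rw [← η.sum_repr (X *ᵥ η b)]
  rw [gradedPart_mulVec]
  simp only [← formB_apply, map_sum, map_smul]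
  split_ifs with hab
  · refine Finset.sum_congr rfl fun i _ => ?_
    split_ifs with hi
    · simp
    · rw [h0 i (by omega)]
      simp
  · refine Finset.sum_eq_zero fun i _ => ?_
    split_ifs with hi
    · rw [map_smul, h0 i (by omega), smul_zero]
    · simp

/-- The homogeneous components of an element of `𝔤` lie in `𝔤`, because the Hodge decomposition is
orthogonal up to the pairing of `H^{p, n - p}` with `H^{n - p, p}`. -/
lemma gradedPart_mem_lieGraded (ho : o ∈ 𝓗.compactDual) (hη : 𝓗.IsAdaptedToDecomposition o η)
    {X : Matrix (Fin m) (Fin m) ℂ} (hX : X ∈ 𝓗.lieG) (k : ℕ) :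
    𝓗.gradedPart η X k ∈ 𝓗.lieGraded o (-(k : ℤ)) := by
  refine ⟨mem_lieG_of_basis (η := η) fun a b => ?_, fun p v hv => ?_⟩
  · rw [form_gradedPart_left ho hη, form_gradedPart_right ho hη]
    split_ifs
    · exact hX _ _
    · exact add_zero 0
  · rw [hη.hodgePiece_eq ho] at hv ⊢
    suffices Submodule.span ℂ (η '' {i | (𝓗.degree i : ℤ) = p}) ≤
        (Submodule.span ℂ (η '' {i | (𝓗.degree i : ℤ) = p + -(k : ℤ)})).comap
          (Matrix.toLin' (𝓗.gradedPart η X k)) by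
      simpa using this hv
    rw [Submodule.span_le]
    rintro _ ⟨j, hj, rfl⟩
    simp only [Set.mem_ofPred_eq] at hj
    rw [SetLike.mem_coe, Submodule.mem_comap, Matrix.toLin'_apply, gradedPart_mulVec]
    refine Submodule.sum_mem _ fun i _ => ?_
    split_ifs with hi
    · refine Submodule.smul_mem _ _ (Submodule.subset_span ⟨i, ?_, rfl⟩)
      simp only [Set.mem_ofPred_eq]
      omega
    · exact zero_mem _

lemma mem_lieNMinus (ho : o ∈ 𝓗.compactDual) (hη : 𝓗.IsAdaptedToDecomposition o η)
    {X : Matrix (Fin m) (Fin m) ℂ} (hX : X ∈ 𝓗.lieG) (hX' : X ∈ 𝓗.lowering η) :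
    X ∈ 𝓗.lieNMinus o := by
  rw [← sum_gradedPart hX']
  refine Submodule.sum_mem _ fun k hk => ?_
  exact Submodule.mem_iSup_of_mem k (Submodule.mem_iSup_of_mem (Finset.mem_Icc.1 hk).1
    (gradedPart_mem_lieGraded ho hη hX k))

/-- A nilpotent logarithm `X` of an isometry is infinitesimally isometric: the function
`t ↦ Q(exp(tX) u, exp(tX) v)` is a polynomial that is constant on the natural numbers, so its
coefficient at `t` vanishes. -/
lemma mem_lieG_of_exp_isometry {X : Matrix (Fin m) (Fin m) ℂ} {N : ℕ} (hX : X ^ N = 0)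
    (h : ∀ u v, 𝓗.form (NormedSpace.exp X *ᵥ u) (NormedSpace.exp X *ᵥ v) = 𝓗.form u v) :
    X ∈ 𝓗.lieG := by
  have hX2 : X ^ (N + 2) = 0 := pow_eq_zero_of_le (by omega) hX
  intro u v
  let P : Polynomial ℂ := ∑ j ∈ Finset.range (N + 2), ∑ k ∈ Finset.range (N + 2),
    Polynomial.C ((j.factorial : ℂ)⁻¹ * (k.factorial : ℂ)⁻¹ * 𝓗.form (X ^ j *ᵥ u) (X ^ k *ᵥ v)) *
      Polynomial.X ^ (j + k)
  have hP : ∀ t : ℕ, P.eval (t : ℂ) = 𝓗.form u v := by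
    intro t
    have h1 : 𝓗.form (NormedSpace.exp (t • X) *ᵥ u) (NormedSpace.exp (t • X) *ᵥ v) =
        𝓗.form u v := by
      rw [Matrix.exp_nsmul]
      induction t with
      | zero => simp
      | succ t ih => rw [pow_succ', ← Matrix.mulVec_mulVec, ← Matrix.mulVec_mulVec, h, ih]
    have h2 : NormedSpace.exp (t • X) = ∑ j ∈ Finset.range (N + 2),
        ((j.factorial : ℂ)⁻¹ * (t : ℂ) ^ j) • X ^ j := by
      rw [Matrix.exp_eq_sum_of_pow_eq_zero (k := N + 2) (by rw [smul_pow, hX2, smul_zero])]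
      refine Finset.sum_congr rfl fun j _ => ?_
      rw [← Nat.cast_smul_eq_nsmul ℂ, smul_pow, smul_smul]
    rw [← h1, h2]
    simp only [Matrix.sum_mulVec, Matrix.smul_mulVec, ← formB_apply, map_sum, map_smul,
      LinearMap.sum_apply, LinearMap.smul_apply, smul_eq_mul, P, Polynomial.eval_finsetSum,
      Polynomial.eval_mul, Polynomial.eval_C, Polynomial.eval_pow, Polynomial.eval_X]
    rw [Finset.sum_comm]
    refine Finset.sum_congr rfl fun j _ => ?_
    rw [Finset.mul_sum]
    refine Finset.sum_congr rfl fun k _ => ?_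
    ring
  have hPC : P = Polynomial.C (𝓗.form u v) := by
    refine Polynomial.eq_of_infinite_eval_eq _ _ (Set.Infinite.mono ?_
      (Set.infinite_range_of_injective (Nat.cast_injective (R := ℂ))))
    rintro _ ⟨t, rfl⟩
    simp [hP t]
  have h1 : P.coeff 1 = 0 := by rw [hPC, Polynomial.coeff_C_of_ne_zero one_ne_zero]
  simp only [P, Polynomial.finsetSum_coeff, Polynomial.coeff_C_mul, Polynomial.coeff_X_pow] at h1
  -- Only the pairs of exponents `(1, 0)` and `(0, 1)` contribute.
  simp [Finset.sum_range_succ'] at h1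
  rwa [Finset.sum_eq_zero fun x _ => Finset.sum_eq_zero fun k _ => if_neg (by omega), zero_add]
    at h1

/-! ### The unipotent orbit inside the compact dual -/

lemma isCompl_lowerSpan (ho : o ∈ 𝓗.periodDomain) (hη : 𝓗.IsAdaptedToDecomposition o η) (p : ℕ) :
    IsCompl (o p) (𝓗.lowerSpan η p) := by
  rw [hη.filtration_eq ho, lowerSpan]
  constructor
  · refine η.linearIndependent.disjoint_span_image ?_
    rw [Set.disjoint_left]
    intro i hi hi'
    simp only [Set.mem_ofPred_eq] at hi hi'
    omega
  · rw [codisjoint_iff, ← Submodule.span_union, ← Set.image_union, eq_top_iff, ← η.span_eq]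
    refine Submodule.span_mono ?_
    rintro _ ⟨i, rfl⟩
    exact ⟨i, le_or_gt p (𝓗.degree i), rfl⟩

lemma sup_lowerSpan_eq_top (ho : o ∈ 𝓗.periodDomain) (hη : 𝓗.IsAdaptedToDecomposition o η)
    (hF : F ∈ 𝓗.compactDual) {p : ℕ} (h : Disjoint (F p) (𝓗.lowerSpan η p)) :
    F p ⊔ 𝓗.lowerSpan η p = ⊤ := by
  refine Submodule.eq_top_of_disjoint _ _ (le_of_eq ?_) h
  rw [finrank_eq_f hF, ← finrank_eq_f ho.1,
    Submodule.finrank_add_eq_of_isCompl (isCompl_lowerSpan ho hη p)]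

lemma form_lowerSpan_eq_zero (ho : o ∈ 𝓗.compactDual) (hη : 𝓗.IsAdaptedToDecomposition o η)
    {p q : ℕ} (hpq : p + q ≤ 𝓗.weight + 1) {u v : Fin m → ℂ} (hu : u ∈ 𝓗.lowerSpan η p)
    (hv : v ∈ 𝓗.lowerSpan η q) : 𝓗.form u v = 0 := by
  refine 𝓗.form_eq_zero_of_mem_span ?_ hu hv
  rintro _ ⟨i, hi, rfl⟩ _ ⟨j, hj, rfl⟩
  simp only [Set.mem_ofPred_eq] at hi hj
  exact hη.form_eq_zero ho (by omega)

lemma disjoint_of_mem_unipotentOrbit (ho : o ∈ 𝓗.periodDomain)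
    (hη : 𝓗.IsAdaptedToDecomposition o η) (hF : F ∈ 𝓗.unipotentOrbit o) (p : ℕ) :
    Disjoint (F p) (𝓗.lowerSpan η p) := by
  obtain ⟨_, ⟨X, hX, rfl⟩, rfl⟩ := hF
  have hX' := lieNMinus_le_lowering ho.1 hη hX
  rw [Submodule.disjoint_def]
  rintro v ⟨u, hu, rfl⟩ hv
  have hu' := exp_mulVec_mem_lowerSpan (neg_mem hX') hv
  rw [Matrix.toLin'_apply, Matrix.mulVec_mulVec, ← Matrix.exp_add_of_commute _ _
    (Commute.neg_left (Commute.refl X)), neg_add_cancel, NormedSpace.exp_zero,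
    Matrix.one_mulVec] at hu'
  rw [Submodule.disjoint_def.1 (isCompl_lowerSpan ho hη p).disjoint u hu hu', map_zero]

/-- If `F` is opposite to the flag `lowerSpan η`, then sending `η i` to the unique vector of
`F^{deg i}` congruent to it modulo lower degrees defines a unipotent matrix `g` that maps `o` to
`F`. The first Hodge-Riemann relation for `F` makes `g` an isometry, so `log g` lies in `𝔫₋`. -/
lemma mem_unipotentOrbit_of_disjoint (ho : o ∈ 𝓗.periodDomain)
    (hη : 𝓗.IsAdaptedToDecomposition o η) (hF : F ∈ 𝓗.compactDual)
    (h : ∀ p ≤ 𝓗.weight, Disjoint (F p) (𝓗.lowerSpan η p)) : F ∈ 𝓗.unipotentOrbit o := by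
  have hex : ∀ i, ∃ a ∈ F (𝓗.degree i), a - η i ∈ 𝓗.lowerSpan η (𝓗.degree i) := by
    intro i
    have htop := sup_lowerSpan_eq_top ho hη hF (h _ (𝓗.degree_le i))
    obtain ⟨a, ha, w, hw, haw⟩ := Submodule.mem_sup.1 (htop ▸ Submodule.mem_top : η i ∈ _)
    refine ⟨a, ha, ?_⟩
    rw [← haw, sub_add_cancel_left]
    exact neg_mem hw
  choose a haF haW using hex
  let N : Matrix (Fin m) (Fin m) ℂ := LinearMap.toMatrix' (η.constr ℂ fun i => a i - η i)
  have hNη : ∀ i, N *ᵥ η i = a i - η i := fun i => by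
    rw [LinearMap.toMatrix'_mulVec, Module.Basis.constr_basis]
  have hN : N ∈ 𝓗.lowering η := mem_lowering_iff.2 fun i => by rw [hNη]; exact haW i
  obtain ⟨X, hX, hXN⟩ := exists_exp_eq_of_mem_lowering hN
  have hg : ∀ i, NormedSpace.exp X *ᵥ η i = a i := fun i => by
    rw [hXN, Matrix.add_mulVec, Matrix.one_mulVec, hNη, add_sub_cancel]
  have ha : ∀ i j, 𝓗.form (a i) (a j) = 𝓗.form (η i) (η j) := by
    intro i j
    -- Either both sides vanish, or they differ by pairings of total degree less than the weight.
    rcases lt_or_ge 𝓗.weight (𝓗.degree i + 𝓗.degree j) with hij | hij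
    · rw [form_eq_zero_of_mem hF hij (haF i) (haF j), hη.form_eq_zero ho.1 hij.ne']
    · have hη' : ∀ i, η i ∈ 𝓗.lowerSpan η (𝓗.degree i + 1) := fun i =>
        basis_mem_lowerSpan (Nat.lt_succ_self _)
      have haj : a j ∈ 𝓗.lowerSpan η (𝓗.degree j + 1) := by
        have := add_mem (lowerSpan_mono (Nat.le_succ _) (haW j)) (hη' j)
        rwa [sub_add_cancel] at this
      have h1 := form_lowerSpan_eq_zero ho.1 hη (by omega) (haW i) haj
      have h2 := form_lowerSpan_eq_zero ho.1 hη (by omega) (hη' i) (haW j)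
      simp only [← formB_apply, map_sub, LinearMap.sub_apply] at h1 h2 ⊢
      linear_combination h1 + h2
  have hiso : ∀ u v, 𝓗.form (NormedSpace.exp X *ᵥ u) (NormedSpace.exp X *ᵥ v) = 𝓗.form u v := by
    have h0 : 𝓗.formB.comp (Matrix.toLin' (NormedSpace.exp X)) (Matrix.toLin' (NormedSpace.exp X)) =
        𝓗.formB :=
      LinearMap.BilinForm.ext_basis η fun i j => by simpa [formB_apply, hg] using ha i j
    intro u v
    simpa [formB_apply] using congrArg (fun B => B u v) h0
  have hXg := mem_lieG_of_exp_isometry (pow_eq_zero_of_mem_lowering hX) hiso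
  refine ⟨NormedSpace.exp X, ⟨X, mem_lieNMinus ho.1 hη hXg hX, rfl⟩, ?_⟩
  funext p
  symm
  refine Submodule.eq_of_le_of_finrank_eq ?_ ?_
  · change (o p).map _ ≤ _
    rw [hη.filtration_eq ho, Submodule.map_span, Submodule.span_le]
    rintro _ ⟨_, ⟨i, hi, rfl⟩, rfl⟩
    rw [Matrix.toLin'_apply, hg]
    exact hF.2.1 hi (haF i)
  · rw [finrank_eq_f hF, ← finrank_eq_f ho.1]
    have hinj : Function.Injective (Matrix.toLin' (NormedSpace.exp X)) :=
      Matrix.mulVec_injective_of_isUnit (Matrix.isUnit_exp X)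
    exact (LinearEquiv.finrank_eq (Submodule.equivMapOfInjective _ hinj (o p))).symm

lemma mem_unipotentOrbit_iff (ho : o ∈ 𝓗.periodDomain) (hη : 𝓗.IsAdaptedToDecomposition o η)
    (hF : F ∈ 𝓗.compactDual) :
    F ∈ 𝓗.unipotentOrbit o ↔ ∀ p ≤ 𝓗.weight, Disjoint (F p) (𝓗.lowerSpan η p) :=
  ⟨fun h p _ => disjoint_of_mem_unipotentOrbit ho hη h p, mem_unipotentOrbit_of_disjoint ho hη hF⟩

/-! ### Block leading principal minors -/

/-- The leading minor of size `f (n - k)` vanishes exactly if some non-zero combination of the first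
`f (n - k)` vectors `ζ i`, that is, some non-zero vector of `F^{n - k}`, has no component along
the first `f (n - k)` vectors `η j`. -/
lemma blockMinor_ne_zero_iff (hζ : 𝓗.IsAdaptedToFiltration F ζ) (k : ℕ) :
    𝓗.blockMinor (transitionMatrix η ζ) k ≠ 0 ↔
      Disjoint (F (𝓗.weight - k)) (𝓗.lowerSpan η (𝓗.weight - k)) := by
  set p := 𝓗.weight - k with hp
  rw [blockMinor, Submodule.disjoint_def, hζ p (Nat.sub_le _ _), ← hp]
  set B := (transitionMatrix η ζ).toSquareBlockProp fun i => (i : ℕ) < 𝓗.f p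
  have hcoord : ∀ (c : Fin m → ℂ) (j : Fin m),
      η.repr (∑ i, c i • ζ i) j = ∑ i, c i * transitionMatrix η ζ i j := by
    intro c j
    simp [transitionMatrix, map_sum, Finsupp.finsetSum_apply]
  have hcoord' : ∀ (c : Fin m → ℂ), (∀ i : Fin m, ¬ (i : ℕ) < 𝓗.f p → c i = 0) →
      ∀ j : {i : Fin m // (i : ℕ) < 𝓗.f p},
        η.repr (∑ i, c i • ζ i) j = ((fun i : {i : Fin m // (i : ℕ) < 𝓗.f p} => c i) ᵥ* B) j := by
    intro c hc j
    have h1 := Fintype.sum_subtype_add_sum_subtype (fun i : Fin m => (i : ℕ) < 𝓗.f p)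
      fun i => c i * transitionMatrix η ζ i j
    rw [Finset.sum_eq_zero (s := (Finset.univ : Finset {i : Fin m // ¬ (i : ℕ) < 𝓗.f p}))
      fun i _ => by rw [hc i i.2, zero_mul], add_zero] at h1
    rw [hcoord]
    exact h1.symm
  constructor
  · intro hdet v hv hv'
    rw [mem_span_image_iff] at hv
    rw [mem_lowerSpan] at hv'
    have h0 := Matrix.eq_zero_of_vecMul_eq_zero hdet
      (v := fun i : {i : Fin m // (i : ℕ) < 𝓗.f p} => ζ.repr v i) (by
        funext j
        rw [← hcoord' (fun i => ζ.repr v i) (fun i hi => hv i hi), ζ.sum_repr]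
        exact hv' j (𝓗.le_degree_iff.2 j.2))
    rw [← ζ.repr.map_eq_zero_iff]
    ext i
    by_cases hi : (i : ℕ) < 𝓗.f p
    · exact congrFun h0 ⟨i, hi⟩
    · exact hv i hi
  · intro h hdet
    obtain ⟨c, hc0, hc⟩ := Matrix.exists_vecMul_eq_zero_iff.2 hdet
    let c' : Fin m → ℂ := fun i => if hi : (i : ℕ) < 𝓗.f p then c ⟨i, hi⟩ else 0
    have hc' : (fun i : {i : Fin m // (i : ℕ) < 𝓗.f p} => c' i) = c := by
      funext i
      simp [c', i.2]
    have hv := h (∑ i, c' i • ζ i) (mem_span_image_iff.2 fun i hi => by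
        rw [ζ.repr_sum_self]; exact dif_neg hi) (mem_lowerSpan.2 fun j hj => by
        rw [hcoord' c' (fun i hi => dif_neg hi) ⟨j, 𝓗.le_degree_iff.1 hj⟩, hc', hc]; rfl)
    refine hc0 ?_
    rw [← hc']
    funext i
    have := congrArg (fun v => ζ.repr v i) hv
    simpa only [ζ.repr_sum_self, map_zero, Finsupp.coe_zero, Pi.zero_apply] using this

lemma mem_unipotentOrbit_iff_blockMinor (ho : o ∈ 𝓗.periodDomain)
    (hη : 𝓗.IsAdaptedToDecomposition o η) (hF : F ∈ 𝓗.compactDual)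
    (hζ : 𝓗.IsAdaptedToFiltration F ζ) :
    F ∈ 𝓗.unipotentOrbit o ↔
      ∀ k ≤ 𝓗.weight, 𝓗.blockMinor (transitionMatrix η ζ) k ≠ 0 := by
  rw [mem_unipotentOrbit_iff ho hη hF]
  simp only [blockMinor_ne_zero_iff hζ]
  refine ⟨fun h k _ => h _ (Nat.sub_le _ _), fun h p hp => ?_⟩
  have := h (𝓗.weight - p) (Nat.sub_le _ _)
  rwa [Nat.sub_sub_self hp] at this

lemma mem_veeLocus_compl_iff {T : Type*} (Ψ : T → 𝓗.periodDomain) (z₀ z : T)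
    (hη : 𝓗.IsAdaptedToDecomposition (Ψ z₀) η) (hζ : 𝓗.IsAdaptedToFiltration (Ψ z) ζ) :
    z ∈ (𝓗.veeLocus Ψ z₀)ᶜ ↔
      ∃ k ≤ 𝓗.weight, 𝓗.blockMinor (transitionMatrix η ζ) k = 0 := by
  have h := mem_unipotentOrbit_iff_blockMinor (Ψ z₀).2 hη (Ψ z).2.1 hζ
  have h' : z ∈ 𝓗.veeLocus Ψ z₀ ↔ (Ψ z : FiltrationSeq m) ∈ 𝓗.unipotentOrbit (Ψ z₀) :=
    and_iff_left (Ψ z).2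
  rw [Set.mem_compl_iff, h', h]
  push Not
  rfl

lemma base_mem_veeLocus {T : Type*} (Ψ : T → 𝓗.periodDomain) (z₀ : T) :
    z₀ ∈ 𝓗.veeLocus Ψ z₀ := by
  refine ⟨⟨1, ⟨0, zero_mem _, NormedSpace.exp_zero⟩, ?_⟩, (Ψ z₀).2⟩
  funext p
  simp [FiltrationSeq.act]

end HodgeData

/-! ### Analytic subsets of connected complex manifolds -/

section AnalyticSubsets

variable {E : Type*} [NormedAddCommGroup E] [NormedSpace ℂ E]
  {M : Type*} [TopologicalSpace M] [ChartedSpace E M]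

lemma IsOpen.isOpenComplexSubmanifold [IsManifold 𝓘(ℂ, E) ω M] {U : Set M} (hU : IsOpen U) :
    IsOpenComplexSubmanifold E U := by
  refine ⟨⟨U, hU⟩, rfl, inferInstance, fun x => ?_⟩
  let e := TopologicalSpace.Opens.openPartialHomeomorphSubtypeCoe ⟨U, hU⟩ ⟨x⟩
  refine ⟨⟨e.toPartialEquiv, e.open_source, e.open_target, contMDiff_subtype_val.contMDiffOn,
    fun y hy => ?_⟩, Set.mem_univ _, fun _ _ => rfl⟩
  have hyU : y ∈ U := by
    have : y ∈ e.target := hy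
    simpa [e] using this
  refine ContMDiffAt.contMDiffWithinAt ?_
  change ContMDiffAt _ _ ω e.symm y
  rw [← contMDiffAt_subtype_iff (U := (⟨U, hU⟩ : TopologicalSpace.Opens M)) (x := ⟨y, hyU⟩)]
  have : (fun z : (⟨U, hU⟩ : TopologicalSpace.Opens M) => e.symm z) = id :=
    funext fun z => e.left_inv (Set.mem_univ z)
  rw [this]
  exact contMDiffAt_id

lemma IsAnalyticSubvariety.isClosed {Z : Set M} (hZ : IsAnalyticSubvariety E Z) : IsClosed Z := by
  rw [← isOpen_compl_iff, isOpen_iff_forall_mem_open]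
  intro x hx
  obtain ⟨U, hU, hxU, N, g, hg, hZU⟩ := hZ x
  have hmem : ∀ y ∈ U, y ∈ Z ↔ ∀ j, g j y = 0 := fun y hy => by
    have := Set.ext_iff.1 hZU y
    simpa [hy] using this
  obtain ⟨j, hj⟩ := not_forall.1 (mt (hmem x hxU).2 hx)
  refine ⟨U ∩ g j ⁻¹' {0}ᶜ, fun y hy hyZ => hy.2 ((hmem y hy.1).1 hyZ j),
    (hg j).continuousOn.isOpen_inter_preimage hU isOpen_compl_singleton, hxU, hj⟩

/-- The identity theorem on a ball, by restriction to the complex lines through `a`. -/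
lemma DifferentiableOn.eqOn_zero_ball_of_eventuallyEq_zero {g : E → ℂ} {c : E} {r : ℝ}
    (hg : DifferentiableOn ℂ g (Metric.ball c r)) {a : E} (ha : a ∈ Metric.ball c r)
    (h0 : g =ᶠ[𝓝 a] 0) : Set.EqOn g 0 (Metric.ball c r) := by
  intro y hy
  let ℓ : ℂ → E := fun t => t • (y - a) + a
  have hℓ : Differentiable ℂ ℓ := by fun_prop
  have hopen : IsOpen (ℓ ⁻¹' Metric.ball c r) := Metric.isOpen_ball.preimage hℓ.continuous
  have hconv : Convex ℝ (ℓ ⁻¹' Metric.ball c r) :=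
    (convex_ball c r).affine_preimage
      (((LinearMap.toSpanSingleton ℂ E (y - a)).restrictScalars ℝ).toAffineMap +
        AffineMap.const ℝ ℂ a)
  have han : AnalyticOnNhd ℂ (g ∘ ℓ) (ℓ ⁻¹' Metric.ball c r) :=
    (hg.comp hℓ.differentiableOn fun _ ht => ht).analyticOnNhd hopen
  have hℓ0 : ℓ 0 = a := by simp [ℓ]
  have hℓ1 : ℓ 1 = y := by simp [ℓ]
  have hev : g ∘ ℓ =ᶠ[𝓝 0] 0 :=
    (hℓ.continuous.tendsto' 0 a hℓ0).eventually h0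
  have h1 := han.eqOn_zero_of_preconnected_of_eventuallyEq_zero hconv.isPreconnected
    (z₀ := 0) (by rwa [Set.mem_preimage, hℓ0]) hev (x := 1) (by rwa [Set.mem_preimage, hℓ1])
  simpa [hℓ1] using h1

/-- An analytic subvariety of a connected manifold with an interior point is everything: its
interior is closed by the identity theorem. -/
lemma IsAnalyticSubvariety.eq_univ_of_interior_nonempty [IsManifold 𝓘(ℂ, E) ω M]
    [PreconnectedSpace M] {Z : Set M} (hZ : IsAnalyticSubvariety E Z)
    (h : (interior Z).Nonempty) : Z = Set.univ := by
  have : IsManifold 𝓘(ℂ, E) 1 M := IsManifold.of_le (n := ω) (by simp)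
  suffices hcl : IsClosed (interior Z) by
    rw [Set.eq_univ_iff_forall]
    intro x
    exact interior_subset ((IsClopen.eq_univ ⟨hcl, isOpen_interior⟩ h) ▸ Set.mem_univ x)
  refine isClosed_of_closure_subset fun x hx => ?_
  obtain ⟨U, hU, hxU, N, g, hg, hZU⟩ := hZ x
  let φ := chartAt E x
  have hφx : x ∈ φ.source := mem_chart_source E x
  have hV : IsOpen (φ.target ∩ φ.symm ⁻¹' U) := φ.symm.isOpen_inter_preimage hU
  have hxV : φ x ∈ φ.target ∩ φ.symm ⁻¹' U :=
    ⟨φ.map_source hφx, by rwa [Set.mem_preimage, φ.left_inv hφx]⟩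
  obtain ⟨r, hr, hball⟩ := Metric.isOpen_iff.1 hV _ hxV
  have hB : IsOpen (φ.source ∩ φ ⁻¹' Metric.ball (φ x) r) :=
    φ.isOpen_inter_preimage Metric.isOpen_ball
  obtain ⟨y, ⟨hyφ, hyr⟩, hyZ⟩ := mem_closure_iff.1 hx _ hB ⟨hφx, Metric.mem_ball_self hr⟩
  have hBZ : φ.source ∩ φ ⁻¹' Metric.ball (φ x) r ⊆ Z := by
    rintro w ⟨hwφ, hwr⟩
    have hwU : w ∈ U := by simpa [φ.left_inv hwφ] using (hball hwr).2
    suffices hw : w ∈ {y ∈ U | ∀ j, g j y = 0} from (hZU ▸ hw : w ∈ Z ∩ U).1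
    refine ⟨hwU, fun j => ?_⟩
    have hd : DifferentiableOn ℂ (g j ∘ φ.symm) (Metric.ball (φ x) r) := by
      rw [← mdifferentiableOn_iff_differentiableOn]
      exact (hg j).comp ((mdifferentiableOn_atlas_symm (chart_mem_atlas E x)).mono
        fun z hz => (hball hz).1) fun z hz => (hball hz).2
    have hyU : y ∈ U := by simpa [φ.left_inv hyφ] using (hball hyr).2
    have hev : g j ∘ φ.symm =ᶠ[𝓝 (φ y)] 0 := by
      have hnhds : interior Z ∩ U ∈ 𝓝 (φ.symm (φ y)) := by
        rw [φ.left_inv hyφ]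
        exact (isOpen_interior.inter hU).mem_nhds ⟨hyZ, hyU⟩
      filter_upwards [(φ.continuousAt_symm (φ.map_source hyφ)).preimage_mem_nhds hnhds] with z hz
      exact (hZU ▸ (⟨interior_subset hz.1, hz.2⟩ : φ.symm z ∈ Z ∩ U) :
        φ.symm z ∈ {y ∈ U | ∀ j, g j y = 0}).2 j
    simpa [φ.left_inv hwφ] using hd.eqOn_zero_ball_of_eventuallyEq_zero hyr hev hwr
  exact mem_interior.2 ⟨_, hBZ, hB, hφx, Metric.mem_ball_self hr⟩

/-- At a regular point of codimension zero, `Z` contains a whole chart domain. -/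
lemma IsAnalyticSubvariety.one_le_analyticCodim [FiniteDimensional ℂ E] [IsManifold 𝓘(ℂ, E) ω M]
    [PreconnectedSpace M] {Z : Set M} (hZ : IsAnalyticSubvariety E Z) (hne : Z ≠ Set.univ) :
    1 ≤ analyticCodim E Z := by
  refine le_iInf₂ fun c hc => ?_
  rw [Nat.one_le_cast, Nat.one_le_iff_ne_zero]
  rintro rfl
  obtain ⟨x, _, φ, _, hxφ, W, hW, hWZ⟩ := hc
  have hWtop : W = ⊤ := by
    refine Submodule.eq_top_of_finrank_eq ?_
    have := W.finrank_quotient_add_finrank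
    rwa [hW, zero_add] at this
  refine hne (hZ.eq_univ_of_interior_nonempty ⟨x, mem_interior.2 ⟨φ.source, fun y hy => ?_,
    φ.open_source, hxφ⟩⟩)
  rw [hWZ y hy, hWtop]
  trivial

lemma mdifferentiableOn_det {ι : Type} [Fintype ι] [DecidableEq ι] {A : M → Matrix ι ι ℂ}
    {U : Set M} (hA : ∀ i j, MDifferentiableOn 𝓘(ℂ, E) 𝓘(ℂ, ℂ) (fun z => A z i j) U) :
    MDifferentiableOn 𝓘(ℂ, E) 𝓘(ℂ, ℂ) (fun z => (A z).det) U := by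
  have h : MDifferentiableOn 𝓘(ℂ, E) 𝓘(ℂ, ℂ)
      (∑ σ : Equiv.Perm ι, ((Equiv.Perm.sign σ : ℤ) : ℂ) • ∏ i, fun z => A z (σ i) i) U :=
    MDifferentiableOn.sum fun σ _ => MDifferentiableOn.const_smul _
      (MDifferentiableOn.prod fun i _ => hA (σ i) i)
  refine h.congr fun z _ => ?_
  simp [Matrix.det_apply']

end AnalyticSubsets

namespace HodgeData

variable {m : ℕ} {𝓗 : HodgeData m} {F : FiltrationSeq m}
  {E : Type*} [NormedAddCommGroup E] [NormedSpace ℂ E]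
  {M : Type*} [TopologicalSpace M] [ChartedSpace E M]

/-! ### Holomorphic adapted frames -/

/-- For a basis it suffices that each vector lies in the right step of the filtration, since the
dimensions agree. -/
lemma isAdaptedToFiltration_of_mem (hF : F ∈ 𝓗.compactDual)
    {ζ : Module.Basis (Fin m) ℂ (Fin m → ℂ)} (hζ : ∀ i, ζ i ∈ F (𝓗.degree i)) :
    𝓗.IsAdaptedToFiltration F ζ := by
  intro k hk
  symm
  simp only [← le_degree_iff]
  refine Submodule.eq_of_le_of_finrank_eq ?_ ?_
  · rw [Submodule.span_le]
    rintro _ ⟨i, hi, rfl⟩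
    exact hF.2.1 hi (hζ i)
  · rw [finrank_eq_f hF, ← 𝓗.card_le_degree k, Set.image_eq_range]
    exact finrank_span_eq_card (ζ.linearIndependent.comp _ Subtype.val_injective)

/-- Near `x` the filtrations have a holomorphic adapted basis: the vectors of an adapted basis at
`x` are combinations of the local frames of the bundles `F^p` at `x`, and the combinations of
these frames with the same constant coefficients stay independent near `x`. -/
lemma exists_holomorphic_adapted_basis {Ψ : M → 𝓗.periodDomain}
    (hΨ : 𝓗.HolomorphicOn E Ψ Set.univ) (x : M) :
    ∃ U : Set M, IsOpen U ∧ x ∈ U ∧ ∃ ζ : M → Module.Basis (Fin m) ℂ (Fin m → ℂ),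
      (∀ i, MDifferentiableOn 𝓘(ℂ, E) 𝓘(ℂ, Fin m → ℂ) (fun z => ζ z i) U) ∧
      ∀ z ∈ U, 𝓗.IsAdaptedToFiltration (Ψ z) (ζ z) := by
  obtain ⟨η, hη⟩ := exists_isAdaptedToDecomposition (Ψ x).2
  choose V hV hxV s hs hsF using fun i => hΨ (𝓗.degree i) (𝓗.degree_le i) x (Set.mem_univ x)
  have hηF : ∀ i, ∃ c : Fin (𝓗.f (𝓗.degree i)) → ℂ, ∑ j, c j • s i j x = η i := by
    intro i
    rw [← Submodule.mem_span_range_iff_exists_fun, (hsF i x (hxV i)).2,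
      hη.filtration_eq (Ψ x).2]
    exact Submodule.subset_span ⟨i, le_refl (𝓗.degree i), rfl⟩
  choose c hc using hηF
  let b : M → Fin m → (Fin m → ℂ) := fun z i => ∑ j, c i j • s i j z
  have hb : ∀ i, MDifferentiableOn 𝓘(ℂ, E) 𝓘(ℂ, Fin m → ℂ) (fun z => b z i) (⋂ i, V i) := by
    intro i
    refine (MDifferentiableOn.sum (t := Finset.univ) fun j _ =>
      ((hs i j).mono (Set.iInter_subset V i)).const_smul (c i j)).congr fun z _ => ?_
    simp [b]
  have hbF : ∀ z ∈ ⋂ i, V i, ∀ i, b z i ∈ (Ψ z : FiltrationSeq m) (𝓗.degree i) := by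
    intro z hz i
    rw [← (hsF i z (Set.mem_iInter.1 hz i)).2]
    exact Submodule.mem_span_range_iff_exists_fun ℂ |>.2 ⟨c i, rfl⟩
  have hdet : ContinuousOn (fun z => (Matrix.of (b z)).det) (⋂ i, V i) := by
    refine MDifferentiableOn.continuousOn (I := 𝓘(ℂ, E)) (I' := 𝓘(ℂ, ℂ))
      (mdifferentiableOn_det fun i j => ?_)
    exact (ContinuousLinearMap.proj (R := ℂ) (φ := fun _ : Fin m => ℂ) j).mdifferentiable
      |>.comp_mdifferentiableOn (hb i)
  have hli : ∀ z, (Matrix.of (b z)).det ≠ 0 ↔ LinearIndependent ℂ (b z) := fun z => by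
    rw [← isUnit_iff_ne_zero, ← Matrix.isUnit_iff_isUnit_det,
      ← Matrix.linearIndependent_rows_iff_isUnit]
    rfl
  classical
  -- Away from the neighbourhood, where the vectors may be dependent, the basis is irrelevant.
  let ζ : M → Module.Basis (Fin m) ℂ (Fin m → ℂ) := fun z =>
    if h : LinearIndependent ℂ (b z) then
      basisOfLinearIndependentOfCardEqFinrank' (b z) h (by simp) else η
  have hζ : ∀ z, (Matrix.of (b z)).det ≠ 0 → ⇑(ζ z) = b z := fun z hz => by
    simp only [ζ, dif_pos ((hli z).1 hz), coe_basisOfLinearIndependentOfCardEqFinrank']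
  refine ⟨(⋂ i, V i) ∩ (fun z => (Matrix.of (b z)).det) ⁻¹' {0}ᶜ,
    hdet.isOpen_inter_preimage (isOpen_iInter_of_finite hV) isOpen_compl_singleton,
    ⟨Set.mem_iInter.2 hxV, ?_⟩, ζ, fun i => ?_, fun z hz => ?_⟩
  · refine (hli x).2 ?_
    have : b x = η := funext hc
    rw [this]
    exact η.linearIndependent
  · exact ((hb i).mono Set.inter_subset_left).congr fun z hz => congrFun (hζ z hz.2) i
  · refine isAdaptedToFiltration_of_mem (Ψ z).2.1 fun i => ?_
    rw [hζ z hz.2]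
    exact hbF z hz.1 i

lemma mdifferentiableOn_blockMinor (η : Module.Basis (Fin m) ℂ (Fin m → ℂ)) {U : Set M}
    {ζ : M → Module.Basis (Fin m) ℂ (Fin m → ℂ)}
    (hζ : ∀ i, MDifferentiableOn 𝓘(ℂ, E) 𝓘(ℂ, Fin m → ℂ) (fun z => ζ z i) U) (k : ℕ) :
    MDifferentiableOn 𝓘(ℂ, E) 𝓘(ℂ, ℂ)
      (fun z => 𝓗.blockMinor (transitionMatrix η (ζ z)) k) U :=
  mdifferentiableOn_det fun i j =>
    (LinearMap.toContinuousLinearMap (η.coord j)).mdifferentiable.comp_mdifferentiableOn (hζ i)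

end HodgeData

end

/-! ### The complement of `S^∨` -/

theorem mainTheorem8 {m : ℕ} (𝓗 : HodgeData m)
    {E : Type*} [NormedAddCommGroup E] [NormedSpace ℂ E] [FiniteDimensional ℂ E]
    {S : Type*} [TopologicalSpace S] [ChartedSpace E S] [IsManifold 𝓘(ℂ, E) ω S] [ConnectedSpace S]
    {T : Type*} [TopologicalSpace T] [ChartedSpace E T] [IsManifold 𝓘(ℂ, E) ω T]
    (π : T → S) (hπ : IsUniversalCovering E π)
    (Γ : Subgroup (GL (Fin m) ℤ)) (hΓ : Γ ≤ 𝓗.GZ)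
    (Φ : S → 𝓗.PeriodQuotient Γ) (hΦ : 𝓗.IsPeriodMap E Γ Φ)
    (Ψ : T → 𝓗.periodDomain) (hΨ : 𝓗.IsLiftedPeriodMap E Γ π Φ Ψ) (z₀ : T) :
    IsOpenComplexSubmanifold E (𝓗.veeLocus Ψ z₀) ∧
    IsAnalyticSubvariety E (𝓗.veeLocus Ψ z₀)ᶜ ∧
    1 ≤ analyticCodim E (𝓗.veeLocus Ψ z₀)ᶜ ∧
    ∀ η : Module.Basis (Fin m) ℂ (Fin m → ℂ), 𝓗.IsAdaptedToDecomposition (Ψ z₀) η →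
      (∀ z : T, ∀ ζ : Module.Basis (Fin m) ℂ (Fin m → ℂ), 𝓗.IsAdaptedToFiltration (Ψ z) ζ →
        (z ∈ (𝓗.veeLocus Ψ z₀)ᶜ ↔
          ∃ k ≤ 𝓗.weight, 𝓗.blockMinor (HodgeData.transitionMatrix η ζ) k = 0)) ∧
      ∀ x : T, ∃ U : Set T, IsOpen U ∧ x ∈ U ∧
        ∃ ζ : T → Module.Basis (Fin m) ℂ (Fin m → ℂ),
          (∀ i, MDifferentiableOn 𝓘(ℂ, E) 𝓘(ℂ, Fin m → ℂ) (fun z => ζ z i) U) ∧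
          (∀ z ∈ U, 𝓗.IsAdaptedToFiltration (Ψ z) (ζ z)) ∧
          (∀ k ≤ 𝓗.weight, MDifferentiableOn 𝓘(ℂ, E) 𝓘(ℂ, ℂ)
            (fun z => 𝓗.blockMinor (HodgeData.transitionMatrix η (ζ z)) k) U) ∧
          (𝓗.veeLocus Ψ z₀)ᶜ ∩ U =
            {z ∈ U | ∃ k ≤ 𝓗.weight,
              𝓗.blockMinor (HodgeData.transitionMatrix η (ζ z)) k = 0} := by
  have hframe : ∀ η : Module.Basis (Fin m) ℂ (Fin m → ℂ), 𝓗.IsAdaptedToDecomposition (Ψ z₀) η →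
      ∀ x : T, ∃ U : Set T, IsOpen U ∧ x ∈ U ∧ ∃ ζ : T → Module.Basis (Fin m) ℂ (Fin m → ℂ),
        (∀ i, MDifferentiableOn 𝓘(ℂ, E) 𝓘(ℂ, Fin m → ℂ) (fun z => ζ z i) U) ∧
        (∀ z ∈ U, 𝓗.IsAdaptedToFiltration (Ψ z) (ζ z)) ∧
        (∀ k ≤ 𝓗.weight, MDifferentiableOn 𝓘(ℂ, E) 𝓘(ℂ, ℂ)
          (fun z => 𝓗.blockMinor (HodgeData.transitionMatrix η (ζ z)) k) U) ∧
        (𝓗.veeLocus Ψ z₀)ᶜ ∩ U = {z ∈ U | ∃ k ≤ 𝓗.weight,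
          𝓗.blockMinor (HodgeData.transitionMatrix η (ζ z)) k = 0} := by
    intro η hη x
    obtain ⟨U, hU, hxU, ζ, hζ, hζF⟩ := HodgeData.exists_holomorphic_adapted_basis hΨ.holomorphic x
    refine ⟨U, hU, hxU, ζ, hζ, hζF, fun k _ => HodgeData.mdifferentiableOn_blockMinor η hζ k, ?_⟩
    ext z
    rw [Set.mem_inter_iff, and_comm]
    exact and_congr_right fun hz => HodgeData.mem_veeLocus_compl_iff Ψ z₀ z hη (hζF z hz)
  have hanalytic : IsAnalyticSubvariety E (𝓗.veeLocus Ψ z₀)ᶜ := by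
    obtain ⟨η, hη⟩ := HodgeData.exists_isAdaptedToDecomposition (Ψ z₀).2
    intro x
    obtain ⟨U, hU, hxU, ζ, -, -, hminor, hZ⟩ := hframe η hη x
    -- A union of zero loci is the zero locus of the product.
    refine ⟨U, hU, hxU, 1, fun _ => ∏ k ∈ Finset.range (𝓗.weight + 1), fun z =>
      𝓗.blockMinor (HodgeData.transitionMatrix η (ζ z)) k, fun _ => ?_, ?_⟩
    · exact MDifferentiableOn.prod fun k hk => hminor k (Finset.mem_range_succ_iff.1 hk)
    · rw [hZ]
      ext z
      simp [Finset.prod_eq_zero_iff]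
  have hopen : IsOpen (𝓗.veeLocus Ψ z₀) := isClosed_compl_iff.1 hanalytic.isClosed
  have := hπ.simplyConnected
  refine ⟨hopen.isOpenComplexSubmanifold, hanalytic, hanalytic.one_le_analyticCodim ?_,
    fun η hη => ⟨fun z ζ hζ => HodgeData.mem_veeLocus_compl_iff Ψ z₀ z hη hζ, hframe η hη⟩⟩
  rw [Ne, Set.compl_univ_iff]
  exact Set.nonempty_iff_ne_empty.1 ⟨z₀, HodgeData.base_mem_veeLocus Ψ z₀⟩
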